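/- Let $n,m,\ell$ be positive integers and let $r\in\{1,2,\dots\}\cup\{\infty\}$. Let $N$ be a nonempty $C^r$ manifold of dimension $n$ (Hausdorff, without boundary, with a countable base), $U\subseteq\mathbb{R}^m$ an open set, $f:N\to\mathbb{R}^m$ an injective $C^r$ map with $f(N)\subseteq U$, and $F:U\to\mathbb{R}^\ell$ a $C^r$ map. For a linear map $\pi\in\mathcal{L}(\mathbb{R}^m,\mathbb{R}^\ell)$ put $F_\pi=F+\pi|_U$. For $s\ge 1$ let $N^{(s)}=\{(q_1,\dots,q_s)\in N^s : q_i\neq q_j \text{ for } i\neq j\}$, an open submanifold of $N^s$; for $g:N\to\mathbb{R}^\ell$ let $g^{(s)}:N^{(s)}\to(\mathbb{R}^\ell)^s$, $g^{(s)}(q_1,\dots,q_s)=(g(q_1),\dots,g(q_s))$; and let $\Delta_s=\{(y,\dots,y) : y\in\mathbb{R}^\ell\}\subseteq(\mathbb{R}^\ell)^s$. A $C^1$ map $g:N\to\mathbb{R}^\ell$ is called a map with normal crossings if for every integer $s\ge 2$ the map $g^{(s)}$ is transverse to $\Delta_s$, that is, $d(g^{(s)})_q(T_qN^{(s)})+T_{g^{(s)}(q)}\Delta_s=T_{g^{(s)}(q)}(\mathbb{R}^\ell)^s$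 for every $q\in N^{(s)}$ with $g^{(s)}(q)\in\Delta_s$. Let $$s_f=\max\Big\{s\ge 1 : \dim\operatorname{span}_{\mathbb{R}}\{f(q_i)-f(q_1) : 2\le i\le s\}=s-1 \text{ for all } (q_1,\dots,q_s)\in N^{(s)}\Big\};$$ the maximum exists and $2\le s_f\le m+1$. If $(s_f-1)\ell>n\,s_f$ and $r>\max\{2n-\ell,0\}$, then there is a set $\Sigma\subseteq\mathcal{L}(\mathbb{R}^m,\mathbb{R}^\ell)=(\mathbb{R}^m)^\ell$ of Lebesgue measure zero such that for every $\pi\in\mathcal{L}(\mathbb{R}^m,\mathbb{R}^\ell)\setminus\Sigma$ the map $F_\pi\circ f:N\to\mathbb{R}^\ell$ is a $C^r$ map with normal crossings and $(F_\pi\circ f)^{(s_f)}(N^{(s_f)})\cap\Delta_{s_f}=\emptyset$, i.e. no $s_f$ distinct points of $N$ have the same image under $F_\pi\circ f$. -/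

import Mathlib

open scoped Manifold ContDiff

noncomputable section

/-- The space `N^(s)` of ordered `s`-tuples of pairwise distinct points of `N`, as an open subset
of the product manifold `N^s`. With this type it carries Mathlib's structure of an open submanifold
of `N^s`. -/
def configSpace (N : Type*) [TopologicalSpace N] [T2Space N] (s : ℕ) :
    TopologicalSpace.Opens (Fin s → N) where
  carrier := {q | Function.Injective q}
  is_open' := by
    have h : {q : Fin s → N | Function.Injective q} =
        ⋂ i : Fin s, ⋂ j : Fin s, {q | i ≠ j → q i ≠ q j} := by
      ext q
      simp only [Set.mem_ofPred_eq, Set.mem_iInter]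
      exact ⟨fun hq i j hij he => hij (hq he), fun hq i j he => by
        by_contra hij
        exact hq i j hij he⟩
    rw [h]
    refine isOpen_iInter_of_finite fun i => isOpen_iInter_of_finite fun j => ?_
    by_cases hij : i = j
    · simp [hij]
    · simpa [hij] using isOpen_ne_fun (continuous_apply i) (continuous_apply j)

/-- The map `g^(s) : N^(s) → P^s`, `(q_1, …, q_s) ↦ (g q_1, …, g q_s)`. -/
def multiMap {N P : Type*} [TopologicalSpace N] [T2Space N] (g : N → P) (s : ℕ)
    (q : configSpace N s) : Fin s → P :=
  fun i => g (q.1 i)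

/-- The diagonal `Δ_s = {(y, …, y)}` of `(ℝ^ℓ)^s`, a linear subspace. -/
def diagonalSubspace (ℓ s : ℕ) : Submodule ℝ (Fin s → EuclideanSpace ℝ (Fin ℓ)) where
  carrier := {z | ∃ y, z = fun _ => y}
  add_mem' := by
    rintro _ _ ⟨a, rfl⟩ ⟨b, rfl⟩
    exact ⟨a + b, rfl⟩
  zero_mem' := ⟨0, rfl⟩
  smul_mem' := by
    rintro c _ ⟨a, rfl⟩
    exact ⟨c • a, rfl⟩

/-- Transversality of a map `g` from a manifold `M` into a vector space `V` to a linear subspace `Z`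
of `V`: at every `q` with `g q ∈ Z` one has `dg_q (T_q M) + T_{g q} Z = T_{g q} V`. Here
`T_{g q} V = V`, and `T_{g q} Z = Z` because `Z` is a linear subspace. -/
def IsTransverseTo {E H M V : Type*} [NormedAddCommGroup E] [NormedSpace ℝ E] [TopologicalSpace H]
    (I : ModelWithCorners ℝ E H) [TopologicalSpace M] [ChartedSpace H M]
    [NormedAddCommGroup V] [NormedSpace ℝ V] (g : M → V) (Z : Submodule ℝ V) : Prop :=
  ∀ q : M, g q ∈ Z → LinearMap.range (mfderiv I 𝓘(ℝ, V) g q).toLinearMap ⊔ Z = ⊤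

/-- A map `g : N → ℝ^ℓ` with normal crossings: it is of class `C^1` and, for every `s ≥ 2`, the map
`g^(s) : N^(s) → (ℝ^ℓ)^s` is transverse to the diagonal. -/
def HasNormalCrossings (n : ℕ) {ℓ : ℕ} {N : Type*} [TopologicalSpace N] [T2Space N]
    [ChartedSpace (EuclideanSpace ℝ (Fin n)) N] (g : N → EuclideanSpace ℝ (Fin ℓ)) : Prop :=
  ContMDiff (𝓡 n) (𝓡 ℓ) 1 g ∧
    ∀ s : ℕ, 2 ≤ s →
      IsTransverseTo (ModelWithCorners.pi fun _ : Fin s => 𝓡 n) (multiMap g s) (diagonalSubspace ℓ s)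

/-- The number `s_f`: the largest `s ≥ 1` (written `s = k + 1`) such that, for all pairwise distinct
`q_1, …, q_s` in `N`, the vectors `f q_i - f q_1` (`2 ≤ i ≤ s`) span a space of dimension `s - 1`.
For an injection `f` of a nonempty manifold of positive dimension (an infinite set) into `ℝ^m` this
is a maximum over a set that contains `2` and is bounded by `m + 1`. -/
def independenceNumber {N : Type*} {m : ℕ} (f : N → EuclideanSpace ℝ (Fin m)) : ℕ :=
  sSup {s : ℕ | ∃ k : ℕ, s = k + 1 ∧ ∀ q : Fin (k + 1) → N, Function.Injective q →
    Module.finrank ℝ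
      (Submodule.span ℝ (Set.range fun i : Fin k => f (q i.succ) - f (q 0))) = k}

/-- The perturbed map `F_π = F + π`. -/
def linearPerturbation {m ℓ : ℕ} (F : EuclideanSpace ℝ (Fin m) → EuclideanSpace ℝ (Fin ℓ))
    (π : EuclideanSpace ℝ (Fin m) →ₗ[ℝ] EuclideanSpace ℝ (Fin ℓ)) :
    EuclideanSpace ℝ (Fin m) → EuclideanSpace ℝ (Fin ℓ) :=
  fun x => F x + π x

/-- The identification of `L(ℝ^m, ℝ^ℓ)` with `(ℝ^m)^ℓ`: a linear map is sent to the entries of its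
representing matrix. -/
def linearMapEntries {m ℓ : ℕ} (π : EuclideanSpace ℝ (Fin m) →ₗ[ℝ] EuclideanSpace ℝ (Fin ℓ)) :
    Fin ℓ → Fin m → ℝ :=
  fun i j => π (EuclideanSpace.single j 1) i

/-- A set of linear maps has Lebesgue measure zero: so has the corresponding set in `(ℝ^m)^ℓ`. -/
def IsLebesgueNull {m ℓ : ℕ}
    (S : Set (EuclideanSpace ℝ (Fin m) →ₗ[ℝ] EuclideanSpace ℝ (Fin ℓ))) : Prop :=
  MeasureTheory.volume (linearMapEntries '' S) = 0

end

/-! For j + 1 distinct points x_i with equal images under F_π ∘ f, the coincidence says π ∘ v(x) =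
w(x), where v(x) sends the basis vectors of ℝ^j to the differences f(x_i) - f(x_0) and w(x) is the
analogous map built from -F ∘ f. If j + 1 ≤ s_f, then v(x) is injective, so for each x the solutions
π form an affine space of codimension jℓ. Locally the pairs (x, π) are parametrized by X × T with T
a fixed linear space, and every π for which transversality fails is a critical value of the
projection to π (`measure_not_surjective_fderiv_comp_sub_eq_zero`). Sard's theorem applies in class
C^k as soon as k > (j+1)n - jℓ. The dimension hypothesis forces n < ℓ, so j = 1 is the worst case,
which is the bound on r. Countably many charts suffice (`exists_null_forall_transverse`).

At s = s_f a coincidence together with transversality would give sℓ ≤ sn + ℓ, against the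
hypothesis. Hence no s_f points coincide, and for s > s_f there is nothing to check.

Sard's theorem (`measure_image_not_surjective_fderiv_eq_zero`) goes by induction on the dimension of
the target. Where df = 0, countably many C^1 parametrizations make df vanish to order k - 1
(`exists_flatCover`), hence f is constant to order k along them, and a Hausdorff measure estimate
finishes. Where df ≠ 0, one component is straightened to a linear form and Fubini reduces to slices.
-/

open Filter Topology Set Asymptotics MeasureTheory
open scoped NNReal ENNReal

/-! ### Straightening a function; integrating flatness. -/

/-- Near a regular point, a real-valued function becomes linear in suitable coordinates. -/
theorem ContDiffAt.exists_local_linearization {E : Type*} [NormedAddCommGroup E] [NormedSpace ℝ E]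
    [CompleteSpace E] {u : E → ℝ} {a : E} {k : ℕ∞ω} (hk0 : k ≠ 0) (hk : k ≠ ((⊤ : ℕ∞) : ℕ∞ω))
    (hu : ContDiffAt ℝ k u a) (hu' : fderiv ℝ u a ≠ 0) :
    ∃ (β : E →L[ℝ] ℝ) (v : E) (Φ Ψ : E → E), β v = 1 ∧ ContinuousAt Φ a ∧
      (∀ x, β (Φ x) = u x) ∧ (∀ᶠ x in 𝓝 a, Ψ (Φ x) = x) ∧
      ∀ᶠ z in 𝓝 (Φ a), ContDiffAt ℝ k Ψ z ∧ u (Ψ z) = β z := by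
  set β := fderiv ℝ u a with hβ
  obtain ⟨v₀, hv₀⟩ : ∃ v, β v ≠ 0 := by
    by_contra! h
    exact hu' (ContinuousLinearMap.ext h)
  set v := (β v₀)⁻¹ • v₀ with hv
  have hβv : β v = 1 := by simp [hv, hv₀]
  -- `Φ` replaces the `β`-coordinate of `x` by `u x`. Its derivative at `a` is the identity, so it
  -- has a local inverse, which turns `u` into `β`.
  set Φ : E → E := fun x => u x • v + (x - β x • v) with hΦ
  have hΦc : ContDiffAt ℝ k Φ a := by
    have : ContDiffAt ℝ k (fun x => β x) a := β.contDiff.contDiffAt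
    fun_prop
  have hΦd : HasFDerivAt Φ ((ContinuousLinearEquiv.refl ℝ E : E ≃L[ℝ] E) : E →L[ℝ] E) a := by
    have h1 : HasFDerivAt u β a := (hu.differentiableAt hk0).hasFDerivAt
    have h2 := (h1.smul_const v).add ((hasFDerivAt_id a).sub ((β.hasFDerivAt (x := a)).smul_const v))
    refine h2.congr_fderiv ?_
    ext y
    simp
  have hβΦ : ∀ x, β (Φ x) = u x := fun x => by simp [hΦ, hβv]
  refine ⟨β, v, Φ, hΦc.localInverse hΦd hk0, hβv, hΦc.continuousAt, hβΦ, ?_, ?_⟩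
  · exact (hΦc.hasStrictFDerivAt' hΦd hk0).eventually_left_inverse
  · filter_upwards [(hΦc.to_localInverse hΦd hk0).eventually hk,
      (hΦc.hasStrictFDerivAt' hΦd hk0).eventually_right_inverse] with z hz hz'
    refine ⟨hz, ?_⟩
    rw [← hβΦ]
    exact congrArg β hz'

/-- If the derivative of `f` along `ψ` is `o(‖y - x‖ ^ k)`, then `f ∘ ψ` deviates from its value at
`x` by `o(‖y - x‖ ^ (k + 1))`. -/
theorem isLittleO_comp_sub_of_fderiv {E F G : Type*} [NormedAddCommGroup E] [NormedSpace ℝ E]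
    [NormedAddCommGroup F] [NormedSpace ℝ F] [NormedAddCommGroup G] [NormedSpace ℝ G]
    {f : F → G} {ψ : E → F} {x : E} {k : ℕ} (hψ : ContDiffAt ℝ 1 ψ x)
    (hf : ContDiffAt ℝ 1 f (ψ x))
    (ho : (fun y => fderiv ℝ f (ψ y)) =o[𝓝 x] fun y => ‖y - x‖ ^ k) :
    (fun y => f (ψ y) - f (ψ x)) =o[𝓝 x] fun y => ‖y - x‖ ^ (k + 1) := by
  have hψb : (fun y => fderiv ℝ ψ y) =O[𝓝 x] fun _ => (1 : ℝ) :=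
    (hψ.continuousAt_fderiv one_ne_zero).isBigO_one ℝ
  have ho' : (fun y => fderiv ℝ (fun y => f (ψ y)) y) =o[𝓝 x] fun y => ‖y - x‖ ^ k := by
    have h1 : (fun y => ‖fderiv ℝ f (ψ y)‖ * ‖fderiv ℝ ψ y‖) =o[𝓝 x]
        fun y => ‖y - x‖ ^ k * 1 := ho.norm_left.mul_isBigO hψb.norm_left
    simp only [mul_one] at h1
    refine IsBigO.trans_isLittleO (IsBigO.of_bound 1 ?_) h1
    filter_upwards [hψ.eventually (by simp), hψ.continuousAt.eventually (hf.eventually (by simp))]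
      with y hy hy'
    have h2 := fderiv_comp y (hy'.differentiableAt one_ne_zero) (hy.differentiableAt one_ne_zero)
    rw [Function.comp_def] at h2
    rw [h2, one_mul, Real.norm_of_nonneg (by positivity)]
    exact ContinuousLinearMap.opNorm_comp_le _ _
  have hd : ∀ᶠ y in 𝓝 x, DifferentiableAt ℝ (fun y => f (ψ y)) y := by
    filter_upwards [(hf.comp x hψ).eventually (by simp)] with y hy
    exact hy.differentiableAt one_ne_zero
  rw [isLittleO_iff] at ho' ⊢
  intro c hc
  obtain ⟨ε, hε, hball⟩ := Metric.eventually_nhds_iff_ball.1 ((ho' hc).and hd)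
  filter_upwards [Metric.ball_mem_nhds x hε] with y hy
  have hsub : Metric.closedBall x (dist y x) ⊆ Metric.ball x ε :=
    Metric.closedBall_subset_ball hy
  have := (convex_closedBall x (dist y x)).norm_image_sub_le_of_norm_fderiv_le (𝕜 := ℝ)
    (f := fun y => f (ψ y)) (C := c * ‖y - x‖ ^ k) (x := x) (y := y)
    (fun z hz => (hball z (hsub hz)).2) (fun z hz => ?_) (by simp) (by simp)
  · refine this.trans_eq ?_
    rw [Real.norm_of_nonneg (by positivity)]
    ring
  · refine (hball z (hsub hz)).1.trans ?_
    rw [Real.norm_of_nonneg (by positivity)]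
    gcongr
    simpa [dist_eq_norm] using hz

/-! ### Flat covers of zero sets. -/

/-- `A` is covered by countably many sets `ψ i '' B i`, with `ψ i` of class `C^1` at the points of
`B i`, such that `g ∘ ψ i` vanishes to order `o(‖y - x‖ ^ k)` at each point `x` of `B i`. -/
def HasFlatCover {E F : Type*} [NormedAddCommGroup E] [NormedSpace ℝ E]
    [NormedAddCommGroup F] (g : E → F) (k : ℕ) (A : Set E) : Prop :=
  ∃ (ψ : ℕ → E → E) (B : ℕ → Set E), A ⊆ ⋃ i, ψ i '' B i ∧ ∀ i, ∀ x ∈ B i,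
    ψ i x ∈ A ∧ ContDiffAt ℝ 1 (ψ i) x ∧ (fun y => g (ψ i y)) =o[𝓝 x] fun y => ‖y - x‖ ^ k

section HasFlatCover

variable {E F : Type*} [NormedAddCommGroup E] [NormedSpace ℝ E] [NormedAddCommGroup F]
  {g : E → F} {k : ℕ} {A : Set E}

theorem hasFlatCover_empty : HasFlatCover g k ∅ :=
  ⟨fun _ => id, fun _ => ∅, by simp, by simp⟩

theorem HasFlatCover.mono {A' : Set E} (h : HasFlatCover g k A) (hA : A' ⊆ A) :
    HasFlatCover g k A' := by
  obtain ⟨ψ, B, hB, H⟩ := h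
  refine ⟨ψ, fun i => B i ∩ ψ i ⁻¹' A', fun x hx => ?_, fun i x hx => ⟨hx.2, (H i x hx.1).2⟩⟩
  obtain ⟨i, y, hy, rfl⟩ := mem_iUnion.1 (hB (hA hx))
  exact mem_iUnion.2 ⟨i, y, ⟨hy, hx⟩, rfl⟩

theorem HasFlatCover.iUnion {A : ℕ → Set E} (h : ∀ i, HasFlatCover g k (A i)) :
    HasFlatCover g k (⋃ i, A i) := by
  choose ψ B hB H using h
  refine ⟨fun i => ψ i.unpair.1 i.unpair.2, fun i => B i.unpair.1 i.unpair.2, fun x hx => ?_,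
    fun i x hx => ⟨mem_iUnion.2 ⟨_, (H _ _ x hx).1⟩, (H _ _ x hx).2⟩⟩
  obtain ⟨i, hi⟩ := mem_iUnion.1 hx
  obtain ⟨j, hj⟩ := mem_iUnion.1 (hB i hi)
  exact mem_iUnion.2 ⟨Nat.pair i j, by simpa using hj⟩

theorem HasFlatCover.sUnion {S : Set (Set E)} (hS : S.Countable)
    (h : ∀ s ∈ S, HasFlatCover g k s) : HasFlatCover g k (⋃₀ S) := by
  rcases S.eq_empty_or_nonempty with rfl | hne
  · simpa using hasFlatCover_empty
  · obtain ⟨s, rfl⟩ := hS.exists_eq_range hne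
    rw [sUnion_range]
    exact HasFlatCover.iUnion fun i => h _ (mem_range_self i)

theorem HasFlatCover.union {A' : Set E} (h : HasFlatCover g k A) (h' : HasFlatCover g k A') :
    HasFlatCover g k (A ∪ A') := by
  rw [← sUnion_pair]
  refine HasFlatCover.sUnion ((countable_singleton _).insert _) ?_
  rintro s (rfl | rfl)
  exacts [h, h']

end HasFlatCover

theorem HasFlatCover.of_nhdsWithin {E F : Type*} [NormedAddCommGroup E] [NormedSpace ℝ E]
    [FiniteDimensional ℝ E] [NormedAddCommGroup F] {g : E → F} {k : ℕ} {A : Set E}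
    (h : ∀ x ∈ A, ∃ t ∈ 𝓝 x, HasFlatCover g k (A ∩ t)) : HasFlatCover g k A := by
  have := FiniteDimensional.proper ℝ E
  refine (HereditarilyLindelofSpace.isLindelof A).induction_on
    (p := fun s => HasFlatCover g k s) (fun s t hst ht => ht.mono hst)
    (fun S hS h => HasFlatCover.sUnion hS h) fun x hx => ?_
  obtain ⟨t, ht, hc⟩ := h x hx
  exact ⟨_, inter_mem_nhdsWithin A ht, hc⟩

/-- Transport of a flat cover from the kernel `K` of a functional, through a parametrization `Ψ`. -/
theorem HasFlatCover.of_submodule {E F : Type*} [NormedAddCommGroup E] [NormedSpace ℝ E]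
    [NormedAddCommGroup F] {g : E → F} {k : ℕ} {A : Set E}
    (K : Submodule ℝ E) (p : E →L[ℝ] K) (hp : Function.Surjective p) (Ψ : E → E) (A' : Set K)
    (hΨ : ∀ z ∈ A', ContDiffAt ℝ 1 Ψ z) (h : HasFlatCover (fun z : K => g (Ψ z)) k A')
    (hA : A = (fun z : K => Ψ z) '' A') : HasFlatCover g k A := by
  obtain ⟨ψ, B, hB, H⟩ := h
  -- A flat cover consists of self-maps of `E`, so the parametrizations of `K` are precomposed with
  -- `p`; being linear and bounded, `p` preserves the order of vanishing.
  refine ⟨fun i y => Ψ (ψ i (p y)), fun i => p ⁻¹' B i, ?_, fun i x hx => ?_⟩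
  · rw [hA]
    rintro _ ⟨z, hz, rfl⟩
    obtain ⟨i, y, hy, rfl⟩ := mem_iUnion.1 (hB hz)
    obtain ⟨y, rfl⟩ := hp y
    exact mem_iUnion.2 ⟨i, y, hy, rfl⟩
  · obtain ⟨h1, h2, h3⟩ := H i (p x) hx
    refine ⟨hA ▸ ⟨_, h1, rfl⟩, ?_, ?_⟩
    · have h4 : ContDiffAt ℝ 1 (fun y => ((ψ i (p y) : K) : E)) x :=
        K.subtypeL.contDiff.contDiffAt.comp x (h2.comp x p.contDiff.contDiffAt)
      exact (hΨ _ h1).comp x h4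
    · refine (h3.comp_tendsto p.continuous.continuousAt).trans_isBigO ?_
      have : (fun y => ‖p y - p x‖) =O[𝓝 x] fun y => ‖y - x‖ := by
        refine (IsBigO.of_bound ‖p‖ (Eventually.of_forall fun y => ?_))
        rw [← map_sub, norm_norm, norm_norm]
        exact p.le_opNorm _
      exact this.pow k

/-- Double induction, on the dimension and then on `k`. Where the derivative also vanishes, a cover
for the derivative of order `k` integrates to order `k + 1`. Elsewhere the zero set lies locally in
a regular hypersurface, and the dimension drops while the order is kept. -/
theorem exists_flatCover {d : ℕ} : ∀ {k : ℕ} {E F : Type} [NormedAddCommGroup E] [NormedSpace ℝ E]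
    [FiniteDimensional ℝ E] [NormedAddCommGroup F] [NormedSpace ℝ F] {g : E → F} {A : Set E},
    Module.finrank ℝ E = d → (∀ x ∈ A, ContDiffAt ℝ k g x ∧ g x = 0) → HasFlatCover g k A := by
  induction d using Nat.strong_induction_on with | _ d ihd
  intro k
  induction k with
  | zero =>
    intro E F _ _ _ _ _ g A hd hA
    refine ⟨fun _ => id, fun _ => A, fun x hx => mem_iUnion.2 ⟨0, by simpa using hx⟩,
      fun _ x hx => ⟨hx, contDiffAt_id, ?_⟩⟩
    have := (hA x hx).1.continuousAt.tendsto
    rw [(hA x hx).2] at this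
    simpa using this
  | succ k ihk =>
    intro E F _ _ _ _ _ g A hd hA
    have hA1 : ∀ x ∈ A, ContDiffAt ℝ 1 g x := fun x hx =>
      (hA x hx).1.of_le (by exact_mod_cast Nat.le_add_left 1 k)
    have hsplit : A = {x ∈ A | fderiv ℝ g x = 0} ∪ {x ∈ A | fderiv ℝ g x ≠ 0} := by
      ext x
      by_cases h : fderiv ℝ g x = 0 <;> simp [h]
    rw [hsplit]
    refine HasFlatCover.union ?_ (HasFlatCover.of_nhdsWithin ?_)
    · obtain ⟨ψ, B, hB, H⟩ := ihk (g := fderiv ℝ g) (A := {x ∈ A | fderiv ℝ g x = 0}) hd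
        fun x hx => ⟨(hA x hx.1).1.fderiv_right (by norm_cast), hx.2⟩
      refine ⟨ψ, B, hB, fun i x hx => ?_⟩
      obtain ⟨h1, h2, h3⟩ := H i x hx
      refine ⟨h1, h2, ?_⟩
      simpa [(hA _ h1.1).2] using isLittleO_comp_sub_of_fderiv h2 (hA1 _ h1.1) h3
    · rintro a ⟨haA, ha⟩
      obtain ⟨w, hw⟩ : ∃ w, fderiv ℝ g a w ≠ 0 := by
        by_contra! h
        exact ha (ContinuousLinearMap.ext h)
      -- A scalar component of `g` that is regular at `a`; its zero set contains `A` and is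
      -- straightened to the hyperplane `K`.
      obtain ⟨l, -, hl⟩ := exists_dual_vector ℝ _ (norm_ne_zero_iff.2 hw)
      have hgd := (hA1 a haA).differentiableAt one_ne_zero
      have hu : ContDiffAt ℝ (k + 1 : ℕ) (fun x => l (g x)) a :=
        l.contDiff.contDiffAt.comp a (hA a haA).1
      have hu' : fderiv ℝ (fun x => l (g x)) a ≠ 0 := by
        have : fderiv ℝ (fun x => l (g x)) a = l.comp (fderiv ℝ g a) :=
          (l.hasFDerivAt.comp a hgd.hasFDerivAt).fderiv
        intro h0
        rw [this] at h0
        have h1 := DFunLike.congr_fun h0 w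
        simp [hl] at h1
        exact hw h1
      have hcast : ((k + 1 : ℕ) : ℕ∞ω) ≠ 0 := by norm_cast
      obtain ⟨β, v, Φ, Ψ, hβv, hΦc, hβΦ, hΨΦ, hΨ⟩ :=
        hu.exists_local_linearization hcast (by simp) hu'
      set K := LinearMap.ker (β : E →ₗ[ℝ] ℝ) with hK
      set p : E →L[ℝ] K :=
        (ContinuousLinearMap.id ℝ E - β.smulRight v).codRestrict K (fun x => by
          simp [hK, hβv]) with hp
      have hpsurj : Function.Surjective p := by
        rintro ⟨z, hz⟩
        refine ⟨z, Subtype.ext ?_⟩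
        have : β z = 0 := hz
        simp [hp, this]
      have hKd : Module.finrank ℝ K < d := by
        rw [← hd]
        refine Submodule.finrank_lt ?_
        intro h
        have : v ∈ K := h ▸ Submodule.mem_top
        have : β v = 0 := this
        simp [hβv] at this
      refine ⟨_, inter_mem hΨΦ (hΦc.eventually hΨ), ?_⟩
      set t := {x | Ψ (Φ x) = x} ∩
        {x | ContDiffAt ℝ ((k + 1 : ℕ) : ℕ∞ω) Ψ (Φ x) ∧ l (g (Ψ (Φ x))) = β (Φ x)} with ht
      set A'' := {x ∈ A | fderiv ℝ g x ≠ 0} ∩ t with hA''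
      have h1le : (1 : ℕ∞ω) ≤ ((k + 1 : ℕ) : ℕ∞ω) := by exact_mod_cast Nat.le_add_left 1 k
      have key : ∀ z ∈ {z : K | Ψ z ∈ A'' ∧ Φ (Ψ z) = z},
          ContDiffAt ℝ ((k + 1 : ℕ) : ℕ∞ω) Ψ z := by
        rintro z ⟨hz, hz'⟩
        have := hz.2.2.1
        rwa [hz'] at this
      refine HasFlatCover.of_submodule K p hpsurj Ψ {z : K | Ψ z ∈ A'' ∧ Φ (Ψ z) = z}
        (fun z hz => (key z hz).of_le h1le) (ihd _ hKd rfl fun z hz => ⟨?_, (hA _ hz.1.1.1).2⟩) ?_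
      · exact (hA _ hz.1.1.1).1.comp z
          ((key z hz).comp z K.subtypeL.contDiff.contDiffAt)
      · ext x
        constructor
        · intro hx
          have hx0 : β (Φ x) = 0 := by rw [hβΦ, (hA x hx.1.1).2, map_zero]
          have hx1 : Ψ (Φ x) = x := hx.2.1
          exact ⟨⟨Φ x, hx0⟩, ⟨by simpa [hx1] using hx, by simp [hx1]⟩, hx1⟩
        · rintro ⟨z, hz, rfl⟩
          exact hz.1

/-! ### Measure of flat images. -/

/-- A locally Hölder version of `HolderOnWith.hausdorffMeasure_image_le`. -/
theorem hausdorffMeasure_image_le_of_dist_lt {X Y : Type*} [MetricSpace X]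
    [SecondCountableTopology X] [MeasurableSpace X] [BorelSpace X] [MetricSpace Y]
    [MeasurableSpace Y] [BorelSpace Y] {h : X → Y} {S T : Set X} {C k : ℝ≥0} {δ d : ℝ}
    (hS : MeasurableSet S) (hTS : T ⊆ S) (hk : 0 < k) (hδ : 0 < δ) (hd : 0 ≤ d)
    (hh : ∀ x ∈ T, ∀ y ∈ T, dist x y < δ → edist (h x) (h y) ≤ C * edist x y ^ (k : ℝ)) :
    μH[d] (h '' T) ≤ (C : ℝ≥0∞) ^ d * μH[k * d] S := by
  rcases isEmpty_or_nonempty X with hX | hX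
  · simp [Set.eq_empty_of_isEmpty]
  -- Two points of a ball of radius `δ / 2` are less than `δ` apart, so `h` is Hölder on each piece.
  -- Making the pieces disjoint lets the measures of their intersections with the measurable set `S`
  -- add up; `T` may be arbitrary.
  set c : ℕ → Set X := fun i => Metric.ball (TopologicalSpace.denseSeq X i) (δ / 2) with hc
  have hcov : ⋃ i, disjointed c i = univ := by
    rw [iUnion_disjointed]
    exact eq_univ_of_forall fun x => by
      obtain ⟨_, hy, i, rfl⟩ := Metric.dense_iff.1 (TopologicalSpace.denseRange_denseSeq X) x
        (δ / 2) (half_pos hδ)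
      exact mem_iUnion.2 ⟨i, by simpa [hc, dist_comm] using hy⟩
  have hT : h '' T = ⋃ i, h '' (T ∩ disjointed c i) := by
    rw [← image_iUnion, ← inter_iUnion, hcov, inter_univ]
  have hS' : S = ⋃ i, S ∩ disjointed c i := by
    rw [← inter_iUnion, hcov, inter_univ]
  calc μH[d] (h '' T) ≤ ∑' i, μH[d] (h '' (T ∩ disjointed c i)) := by
        rw [hT]; exact measure_iUnion_le _
    _ ≤ ∑' i, (C : ℝ≥0∞) ^ d * μH[k * d] (S ∩ disjointed c i) := by
        refine ENNReal.tsum_le_tsum fun i => ?_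
        have hol : HolderOnWith C k h (T ∩ disjointed c i) := by
          intro x hx y hy
          refine hh x hx.1 y hy.1 ?_
          have h1 : dist x _ < _ := disjointed_subset c i hx.2
          have h2 : dist y _ < _ := disjointed_subset c i hy.2
          linarith [dist_triangle_right x y (TopologicalSpace.denseSeq X i)]
        refine (hol.hausdorffMeasure_image_le hk hd).trans ?_
        gcongr
    _ = (C : ℝ≥0∞) ^ d * μH[k * d] S := by
        rw [ENNReal.tsum_mul_left]
        conv_rhs => rw [hS']
        rw [measure_iUnion]
        · exact fun i j hij => ((disjoint_disjointed c) hij).mono inter_subset_right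
            inter_subset_right
        · exact fun i => hS.inter (MeasurableSet.disjointed (fun _ => measurableSet_ball) i)

/-- A map that is `o(‖y - x‖ ^ k)`-flat at the points `x` of `B` sends `B` to a null set, as soon as
`k * dim F ≥ dim E`. -/
theorem measure_image_eq_zero_of_isLittleO {E F : Type*} [NormedAddCommGroup E] [NormedSpace ℝ E]
    [FiniteDimensional ℝ E] [NormedAddCommGroup F] [NormedSpace ℝ F] [FiniteDimensional ℝ F]
    [MeasurableSpace F] [BorelSpace F] (μ : Measure F) [μ.IsAddHaarMeasure]
    {h : E → F} {k : ℕ} {B : Set E} (hk : 0 < k) (hF : 0 < Module.finrank ℝ F)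
    (hEF : Module.finrank ℝ E ≤ k * Module.finrank ℝ F)
    (ho : ∀ x ∈ B, (fun y => h y - h x) =o[𝓝 x] fun y => ‖y - x‖ ^ k) : μ (h '' B) = 0 := by
  let _ : MeasurableSpace E := borel E
  have : BorelSpace E := ⟨rfl⟩
  have := FiniteDimensional.proper ℝ E
  have := FiniteDimensional.proper ℝ F
  have := isAddHaarMeasure_hausdorffMeasure (E := F)
  have := isAddHaarMeasure_hausdorffMeasure (E := E)
  refine Measure.absolutelyContinuous_isAddHaarMeasure μ (μH[Module.finrank ℝ F]) ?_
  set d : ℝ := (Module.finrank ℝ F : ℝ) with hd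
  have hd0 : 0 < d := Nat.cast_pos.2 hF
  -- The exponent is at least dim E: the measure is a Haar measure in case of equality and zero
  -- otherwise.
  have hfin : ∀ R : ℝ, μH[((k : ℝ≥0) : ℝ) * d] (Metric.closedBall (0 : E) R) < ⊤ := fun R => by
    rcases hEF.eq_or_lt with h1 | h1
    · have : ((k : ℝ≥0) : ℝ) * d = Module.finrank ℝ E := by rw [h1]; simp [hd]
      rw [this]
      exact (isCompact_closedBall 0 R).measure_lt_top
    · have : (Module.finrank ℝ E : ℝ) < ((k : ℝ≥0) : ℝ) * d := by
        simp only [NNReal.coe_natCast, hd]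
        exact_mod_cast h1
      rw [Real.hausdorffMeasure_of_finrank_lt this]
      simp
  have hB : B = ⋃ R : ℕ, B ∩ Metric.closedBall 0 R := by
    rw [← inter_iUnion, Metric.iUnion_closedBall_nat, inter_univ]
  rw [hB, image_iUnion, measure_iUnion_null_iff]
  intro R
  -- The `o`-estimate allows every positive Hölder constant `C`; letting `C` tend to zero kills the
  -- finite right-hand side.
  have key : ∀ C : ℝ≥0, 0 < C → μH[d] (h '' (B ∩ Metric.closedBall 0 R)) ≤
      (C : ℝ≥0∞) ^ d * μH[((k : ℝ≥0) : ℝ) * d] (Metric.closedBall (0 : E) R) := by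
    intro C hC
    set T : ℕ → Set E := fun j => {x ∈ B ∩ Metric.closedBall 0 R | ∀ y, dist y x < 1 / (j + 1 : ℝ) →
      ‖h y - h x‖ ≤ C * ‖y - x‖ ^ k} with hT
    have hTmono : Monotone T := by
      intro i j hij x hx
      refine ⟨hx.1, fun y hy => hx.2 y (hy.trans_le ?_)⟩
      exact one_div_le_one_div_of_le (by positivity) (by exact_mod_cast Nat.succ_le_succ hij)
    have hTB : B ∩ Metric.closedBall 0 R = ⋃ j, T j := by
      refine Subset.antisymm (fun x hx => ?_) (iUnion_subset fun j x hx => hx.1)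
      have := (isLittleO_iff.1 (ho x hx.1)) (NNReal.coe_pos.2 hC)
      obtain ⟨ε, hε, hb⟩ := Metric.eventually_nhds_iff.1 this
      obtain ⟨j, hj⟩ := exists_nat_one_div_lt hε
      refine mem_iUnion.2 ⟨j, hx, fun y hy => ?_⟩
      simpa using hb (hy.trans hj)
    rw [hTB, image_iUnion, Monotone.measure_iUnion fun i j hij => image_mono (hTmono hij)]
    refine iSup_le fun j => ?_
    refine hausdorffMeasure_image_le_of_dist_lt (δ := 1 / (j + 1 : ℝ)) measurableSet_closedBall
      (fun x hx => hx.1.2) (by exact_mod_cast hk) (by positivity) hd0.le fun x hx y hy hxy => ?_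
    have := hy.2 x hxy
    rw [edist_dist, edist_dist, ENNReal.ofReal_rpow_of_nonneg dist_nonneg (by positivity),
      ← ENNReal.ofReal_coe_nnreal, ← ENNReal.ofReal_mul C.coe_nonneg]
    refine ENNReal.ofReal_le_ofReal ?_
    simpa [dist_eq_norm] using this
  have hlim : Tendsto (fun C : ℝ≥0 => (C : ℝ≥0∞) ^ d *
      μH[((k : ℝ≥0) : ℝ) * d] (Metric.closedBall (0 : E) R)) (𝓝[>] 0) (𝓝 0) := by
    have h1 : Tendsto (fun C : ℝ≥0 => (C : ℝ≥0∞) ^ d) (𝓝[>] 0) (𝓝 0) := by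
      have h2 : Continuous fun C : ℝ≥0 => (C : ℝ≥0∞) ^ d :=
        (ENNReal.continuous_rpow_const).comp ENNReal.continuous_coe
      have h3 := h2.tendsto 0
      simp only [ENNReal.coe_zero, ENNReal.zero_rpow_of_pos hd0] at h3
      exact h3.mono_left nhdsWithin_le_nhds
    simpa using ENNReal.Tendsto.mul_const h1 (Or.inr (hfin R).ne)
  exact le_antisymm (ge_of_tendsto hlim (eventually_mem_nhdsWithin.mono fun C hC => key C hC))
    zero_le

/-! ### Sard's theorem. -/

theorem ContinuousLinearMap.isClosed_not_surjective (E F : Type*) [NormedAddCommGroup E]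
    [NormedSpace ℝ E] [NormedAddCommGroup F] [NormedSpace ℝ F] [FiniteDimensional ℝ F] :
    IsClosed {T : E →L[ℝ] F | ¬ Function.Surjective T} := by
  have h := (isOpen_setOfPred_nat_le_rank (𝕜 := ℝ) (E := E) (F := F)
    (Module.finrank ℝ F)).isClosed_compl
  convert h using 1
  ext T
  simp only [mem_ofPred_eq, mem_compl_iff, not_iff_not]
  have h1 : (T : E →ₗ[ℝ] F).rank = (Module.finrank ℝ (LinearMap.range (T : E →ₗ[ℝ] F)) : Cardinal) :=
    (Module.finrank_eq_rank ℝ _).symm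
  rw [h1, Nat.cast_le]
  have h2 : Function.Surjective T ↔ LinearMap.range (T : E →ₗ[ℝ] F) = ⊤ :=
    LinearMap.range_eq_top.symm
  rw [h2]
  refine ⟨fun h => by rw [h, finrank_top], fun h => ?_⟩
  exact Submodule.eq_top_of_finrank_eq (le_antisymm (Submodule.finrank_le _) h)

/-- **Sard's theorem** at the points where the derivative vanishes. -/
theorem measure_image_eq_zero_of_fderiv_eq_zero {E F : Type} [NormedAddCommGroup E]
    [NormedSpace ℝ E] [FiniteDimensional ℝ E] [NormedAddCommGroup F] [NormedSpace ℝ F]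
    [FiniteDimensional ℝ F] [MeasurableSpace F] [BorelSpace F] (μ : Measure F)
    [μ.IsAddHaarMeasure] {f : E → F} {k : ℕ} {A : Set E} (hk : 0 < k)
    (hF : 0 < Module.finrank ℝ F) (hEF : Module.finrank ℝ E < Module.finrank ℝ F + k)
    (hA : ∀ x ∈ A, ContDiffAt ℝ k f x ∧ fderiv ℝ f x = 0) : μ (f '' A) = 0 := by
  obtain ⟨k, rfl⟩ : ∃ j, k = j + 1 := ⟨k - 1, by omega⟩
  obtain ⟨ψ, B, hB, H⟩ := exists_flatCover (g := fderiv ℝ f) (k := k) (A := A) rfl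
    fun x hx => ⟨(hA x hx).1.fderiv_right (by norm_cast), (hA x hx).2⟩
  have hsub : f '' A ⊆ ⋃ i, (fun y => f (ψ i y)) '' B i := by
    refine (image_mono hB).trans ?_
    rw [image_iUnion]
    exact iUnion_mono fun i => by rw [image_image]
  refine measure_mono_null hsub ((measure_iUnion_null_iff).2 fun i => ?_)
  refine measure_image_eq_zero_of_isLittleO μ k.succ_pos hF ?_ fun x hx => ?_
  -- With `k` lowered by one: dim E ≤ dim F + k ≤ (k + 1) dim F, because dim F ≥ 1.
  · nlinarith
  · obtain ⟨h1, h2, h3⟩ := H i x hx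
    exact isLittleO_comp_sub_of_fderiv h2
      ((hA _ h1).1.of_le (by exact_mod_cast Nat.le_add_left 1 k)) h3

theorem ContinuousLinearMap.finrank_ker_add_one {E : Type*} [NormedAddCommGroup E]
    [NormedSpace ℝ E] [FiniteDimensional ℝ E] {β : E →L[ℝ] ℝ} {v : E} (hv : β v = 1) :
    Module.finrank ℝ (LinearMap.ker (β : E →ₗ[ℝ] ℝ)) + 1 = Module.finrank ℝ E := by
  refine Module.Dual.finrank_ker_add_one_of_ne_zero (f := (β : E →ₗ[ℝ] ℝ)) fun h => ?_
  have := DFunLike.congr_fun h v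
  simp [hv] at this

/-- Fubini's theorem for null sets, with respect to the fibres of a linear functional. -/
theorem measure_eq_zero_of_slices {F : Type*} [NormedAddCommGroup F] [NormedSpace ℝ F]
    [FiniteDimensional ℝ F] [MeasurableSpace F] [BorelSpace F] (μ : Measure F)
    [μ.IsAddHaarMeasure] {l : F →L[ℝ] ℝ} {w : F} (hw : l w = 1) {S : Set F} (hS : IsCompact S)
    (ν : Measure (LinearMap.ker (l : F →ₗ[ℝ] ℝ))) [ν.IsAddHaarMeasure]
    (h : ∀ t : ℝ, ν {y | t • w + (y : F) ∈ S} = 0) : μ S = 0 := by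
  have := FiniteDimensional.proper ℝ F
  have : ProperSpace (LinearMap.ker (l : F →ₗ[ℝ] ℝ)) := FiniteDimensional.proper ℝ _
  set e : F ≃L[ℝ] ℝ × LinearMap.ker (l : F →ₗ[ℝ] ℝ) := ContinuousLinearEquiv.equivOfRightInverse l
    (ContinuousLinearMap.toSpanSingleton ℝ w) (fun t => by simp [hw])
  have hac : μ.map e ≪ (volume : Measure ℝ).prod ν :=
    Measure.absolutelyContinuous_isAddHaarMeasure _ _
  have hSe : MeasurableSet (e '' S) := (hS.image e.continuous).measurableSet
  have h0 : ((volume : Measure ℝ).prod ν) (e '' S) = 0 := by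
    rw [Measure.measure_prod_null hSe]
    refine Eventually.of_forall fun t => ?_
    refine measure_mono_null ?_ (h t)
    rintro y ⟨s, hs, hsy⟩
    have : s = t • w + (y : F) := by
      rw [← e.symm_apply_apply s, hsy]
      simp [e]
    rw [this] at hs
    exact hs
  have h1 := hac h0
  rwa [Measure.map_apply e.continuous.measurable hSe, preimage_image_eq _ e.injective] at h1

/-- **Sard's theorem**: the critical values of a map `f : E → F` of class `C^k`, with `k ≥ 1` and
`k ≥ dim E - dim F + 1`, form a null set. -/
theorem measure_image_not_surjective_fderiv_eq_zero {d : ℕ} : ∀ {E F : Type} [NormedAddCommGroup E]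
    [NormedSpace ℝ E] [FiniteDimensional ℝ E] [NormedAddCommGroup F] [NormedSpace ℝ F]
    [FiniteDimensional ℝ F] [MeasurableSpace F] [BorelSpace F] (μ : Measure F)
    [μ.IsAddHaarMeasure] {f : E → F} {k : ℕ} {A : Set E}, Module.finrank ℝ F = d → 0 < k →
    Module.finrank ℝ E < Module.finrank ℝ F + k →
    (∀ x ∈ A, ContDiffAt ℝ k f x ∧ ¬ Function.Surjective (fderiv ℝ f x)) → μ (f '' A) = 0 := by
  induction d with
  | zero =>
    intro E F _ _ _ _ _ _ _ _ μ _ f k A hF _ _ hA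
    have : A = ∅ := eq_empty_of_forall_notMem fun x hx => (hA x hx).2 fun y =>
      ⟨0, by have := Module.finrank_zero_iff.1 hF; exact Subsingleton.elim _ _⟩
    simp [this]
  | succ d ih =>
    intro E F _ _ _ _ _ _ _ _ μ _ f k A hF hk hEF hA
    have := FiniteDimensional.proper ℝ E
    have := FiniteDimensional.proper ℝ F
    have hk0 : (k : ℕ∞ω) ≠ 0 := by exact_mod_cast hk.ne'
    have hk1 : (1 : ℕ∞ω) ≤ k := by exact_mod_cast hk
    have hsplit : f '' A = f '' {x ∈ A | fderiv ℝ f x = 0} ∪ f '' {x ∈ A | fderiv ℝ f x ≠ 0} := by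
      rw [← image_union]
      congr 1
      ext x
      by_cases h : fderiv ℝ f x = 0 <;> simp [h]
    rw [hsplit, measure_union_null_iff]
    refine ⟨measure_image_eq_zero_of_fderiv_eq_zero μ hk (by omega) hEF
      fun x hx => ⟨(hA x hx.1).1, hx.2⟩, ?_⟩
    refine (HereditarilyLindelofSpace.isLindelof {x ∈ A | fderiv ℝ f x ≠ 0}).induction_on
      (p := fun s => μ (f '' s) = 0) (fun s t hst ht => measure_mono_null (image_mono hst) ht)
      (fun S hS h => by
        rw [sUnion_eq_biUnion, image_iUnion₂]
        exact (measure_biUnion_null_iff hS).2 h) ?_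
    rintro a ⟨haA, ha⟩
    obtain ⟨w₀, hw₀⟩ : ∃ w, fderiv ℝ f a w ≠ 0 := by
      by_contra! h
      exact ha (ContinuousLinearMap.ext h)
    obtain ⟨l, -, hl⟩ := exists_dual_vector ℝ _ (norm_ne_zero_iff.2 hw₀)
    have hl0 : l (fderiv ℝ f a w₀) ≠ 0 := by
      rw [hl]
      simpa using hw₀
    obtain ⟨w, hw⟩ : ∃ w, l w = 1 :=
      ⟨(l (fderiv ℝ f a w₀))⁻¹ • fderiv ℝ f a w₀, by simp [hl0]⟩
    have hfd := (hA a haA).1.differentiableAt hk0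
    have hu : ContDiffAt ℝ k (fun x => l (f x)) a :=
      l.contDiff.contDiffAt.comp a (hA a haA).1
    have hu' : fderiv ℝ (fun x => l (f x)) a ≠ 0 := by
      have : fderiv ℝ (fun x => l (f x)) a = l.comp (fderiv ℝ f a) :=
        (l.hasFDerivAt.comp a hfd.hasFDerivAt).fderiv
      intro h0
      rw [this] at h0
      exact hl0 (DFunLike.congr_fun h0 w₀)
    obtain ⟨β, v, Φ, Ψ, hβv, hΦc, hβΦ, hΨΦ, hΨ⟩ :=
      hu.exists_local_linearization hk0 (by simp) hu'
    have hΨa : Ψ (Φ a) = a := hΨΦ.self_of_nhds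
    have hgood : ∀ᶠ z in 𝓝 (Φ a), ContDiffAt ℝ k Ψ z ∧ ContDiffAt ℝ k f (Ψ z) ∧
        ∀ᶠ z' in 𝓝 z, l (f (Ψ z')) = β z' := by
      have h1 : ContinuousAt Ψ (Φ a) := hΨ.self_of_nhds.1.continuousAt
      have h2 : ∀ᶠ x in 𝓝 (Ψ (Φ a)), ContDiffAt ℝ k f x := by
        rw [hΨa]
        exact (hA a haA).1.eventually (by simp)
      filter_upwards [hΨ, h1.eventually h2, eventually_eventually_nhds.2 hΨ] with z h3 h4 h5
      exact ⟨h3.1, h4, h5.mono fun z' h => h.2⟩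
    obtain ⟨ε, hε, hball⟩ := Metric.nhds_basis_closedBall.eventually_iff.1 hgood
    set h : E → F := fun z => f (Ψ z) with hh
    have hhc : ∀ z ∈ Metric.closedBall (Φ a) ε, ContDiffAt ℝ k h z := fun z hz =>
      (hball hz).2.1.comp z (hball hz).1
    -- The arbitrary set `A` is enlarged locally to all critical points of `h` in a closed ball;
    -- this set is compact, so its image is measurable and Fubini applies.
    set C : Set E := Metric.closedBall (Φ a) ε ∩
      fderiv ℝ h ⁻¹' {T | ¬ Function.Surjective T} with hC
    have hCcomp : IsCompact C := by
      refine (isCompact_closedBall (Φ a) ε).of_isClosed_subset ?_ inter_subset_left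
      refine ContinuousOn.preimage_isClosed_of_isClosed (fun z hz => ?_) Metric.isClosed_closedBall
        (ContinuousLinearMap.isClosed_not_surjective E F)
      exact ((hhc z hz).continuousAt_fderiv hk0).continuousWithinAt
    have hSc : IsCompact (h '' C) := hCcomp.image_of_continuousOn fun z hz =>
      (hhc z hz.1).continuousAt.continuousWithinAt
    refine ⟨_, inter_mem_nhdsWithin _ (inter_mem hΨΦ
      (hΦc.preimage_mem_nhds (Metric.closedBall_mem_nhds _ hε))),
      measure_mono_null (t := h '' C) ?_ ?_⟩
    · rintro _ ⟨x, ⟨hxA, hx1, hx2⟩, rfl⟩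
      have hx1 : Ψ (Φ x) = x := hx1
      refine ⟨Φ x, ⟨hx2, fun hs => (hA x hxA.1).2 ?_⟩, by simp [hh, hx1]⟩
      have h1 := fderiv_comp (Φ x) (g := f) (f := Ψ) ((hball hx2).2.1.differentiableAt hk0)
        ((hball hx2).1.differentiableAt hk0)
      have h2 : Function.Surjective (fderiv ℝ (f ∘ Ψ) (Φ x)) := hs
      rw [h1, hx1] at h2
      exact Function.Surjective.of_comp h2
    · refine measure_eq_zero_of_slices μ hw hSc Measure.addHaar fun t => ?_
      set K := LinearMap.ker (β : E →ₗ[ℝ] ℝ)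
      set L := LinearMap.ker (l : F →ₗ[ℝ] ℝ)
      have hK : Module.finrank ℝ K + 1 = _ := ContinuousLinearMap.finrank_ker_add_one hβv
      have hL : Module.finrank ℝ L + 1 = _ := ContinuousLinearMap.finrank_ker_add_one hw
      set q : F →L[ℝ] L := (ContinuousLinearMap.id ℝ F - l.smulRight w).codRestrict L
        (fun x => by simp [L, hw]) with hq
      have hqv : ∀ y, (q y : F) = y - l y • w := fun y => rfl
      -- Since `l ∘ h = β` on the ball, `h` carries the slice `β = t` into `l = t`. Both dimensions
      -- drop by one, so the smoothness requirement is unchanged.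
      set ht : K → L := fun z => q (h (t • v + z)) with hht
      have haff : ∀ z : K, HasFDerivAt (fun z : K => t • v + (z : E)) K.subtypeL z :=
        fun z => K.subtypeL.hasFDerivAt.const_add _
      refine measure_mono_null (t := ht '' {z : K | t • v + (z : E) ∈ C}) ?_
        (ih Measure.addHaar (k := k) (by omega) hk (by omega) fun z hz => ⟨?_, fun hs => hz.2 ?_⟩)
      · rintro y ⟨z, hz, hzy⟩
        have hly : l y = 0 := y.2
        have hlt : β z = t := by
          rw [← (hball hz.1).2.2.self_of_nhds]
          change l (h z) = t
          rw [hzy]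
          simp [hw, hly]
        refine ⟨⟨z - t • v, by simp [K, hβv, hlt]⟩, by simpa using hz, Subtype.ext ?_⟩
        simp [hht, hqv, hzy, hw, hly]
      · have h1 : ContDiffAt ℝ k (fun z : K => t • v + (z : E)) z :=
          (contDiff_const.add K.subtypeL.contDiff).contDiffAt
        exact q.contDiff.contDiffAt.comp z (ContDiffAt.comp (g := h) z (hhc _ hz.1) h1)
      · set T := fderiv ℝ h (t • v + (z : E)) with hT
        have hTd : HasFDerivAt h T (t • v + (z : E)) :=
          ((hhc _ hz.1).differentiableAt hk0).hasFDerivAt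
        have hlT : ∀ ξ, l (T ξ) = β ξ := by
          have h1 : HasFDerivAt (fun z => l (h z)) (l.comp T) (t • v + (z : E)) :=
            l.hasFDerivAt.comp _ hTd
          have h2 : HasFDerivAt (fun z => l (h z)) β (t • v + (z : E)) :=
            β.hasFDerivAt.congr_of_eventuallyEq (hball hz.1).2.2
          exact fun ξ => DFunLike.congr_fun (h1.unique h2) ξ
        have hder : fderiv ℝ ht z = q.comp (T.comp K.subtypeL) :=
          (q.hasFDerivAt.comp z (HasFDerivAt.comp (g := h) z hTd (haff z))).fderiv
        rw [hder] at hs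
        intro y
        -- As `l (T v) = β v = 1`, subtracting `l y • T v` puts `y` into the kernel of `l`, where
        -- surjectivity of the slice derivative takes over. So a critical point of `h` is critical
        -- for its slice map.
        obtain ⟨κ, hκ⟩ := hs (q (y - l y • T v))
        have hκ0 : β κ = 0 := κ.2
        have h1 : T κ - l (T κ) • w = y - l y • T v - l (y - l y • T v) • w :=
          congrArg Subtype.val hκ
        refine ⟨l y • v + κ, ?_⟩
        have h2 : T κ = y - l y • T v := by simpa [hlT, hκ0, hβv] using h1
        rw [map_add, map_smul, h2]
        abel

/-! ### Parametric transversality for linear perturbations. -/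

theorem ContinuousLinearMap.finrank_eq_mul (K P : Type*) [NormedAddCommGroup K]
    [NormedSpace ℝ K] [FiniteDimensional ℝ K] [NormedAddCommGroup P] [NormedSpace ℝ P]
    [FiniteDimensional ℝ P] :
    Module.finrank ℝ (K →L[ℝ] P) = Module.finrank ℝ K * Module.finrank ℝ P := by
  rw [← Module.finrank_linearMap ℝ ℝ K P]
  exact (LinearMap.toContinuousLinearMap (𝕜 := ℝ) (E := K) (F' := P)).finrank_eq.symm

theorem contDiff_snd_coe {k : ℕ∞ω} (X : Type*) {G : Type*} [NormedAddCommGroup X]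
    [NormedSpace ℝ X] [NormedAddCommGroup G] [NormedSpace ℝ G] (T : Submodule ℝ G) :
    ContDiff ℝ k fun p : X × T => (p.2 : G) :=
  T.subtypeL.contDiff.comp contDiff_snd

/-- **Parametric transversality for linear perturbations**: if `v x` is injective for all `x ∈ A`,
then for almost every `π` the map `x ↦ π ∘ v x - w x` is a submersion at its zeros in `A`. -/
theorem measure_not_surjective_fderiv_comp_sub_eq_zero {X K M P : Type}
    [NormedAddCommGroup X] [NormedSpace ℝ X] [FiniteDimensional ℝ X]
    [NormedAddCommGroup K] [NormedSpace ℝ K] [FiniteDimensional ℝ K]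
    [NormedAddCommGroup M] [NormedSpace ℝ M] [FiniteDimensional ℝ M]
    [NormedAddCommGroup P] [NormedSpace ℝ P] [FiniteDimensional ℝ P]
    (μ : Measure (M →L[ℝ] P)) [μ.IsAddHaarMeasure]
    {v : X → K →L[ℝ] M} {w : X → K →L[ℝ] P} {k : ℕ} {A : Set X} (hk : 0 < k)
    (hdim : Module.finrank ℝ X < Module.finrank ℝ K * Module.finrank ℝ P + k)
    (hA : ∀ x ∈ A, ContDiffAt ℝ k v x ∧ ContDiffAt ℝ k w x ∧ Function.Injective (v x)) :
    μ {π : M →L[ℝ] P | ∃ x ∈ A, π.comp (v x) = w x ∧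
      ¬ Function.Surjective (fderiv ℝ (fun y => π.comp (v y) - w y) x)} = 0 := by
  have := FiniteDimensional.proper ℝ X
  have := FiniteDimensional.complete ℝ K
  have hk0 : (k : ℕ∞ω) ≠ 0 := by exact_mod_cast hk.ne'
  refine (HereditarilyLindelofSpace.isLindelof A).induction_on
    (p := fun s => μ {π : M →L[ℝ] P | ∃ x ∈ s, π.comp (v x) = w x ∧
      ¬ Function.Surjective (fderiv ℝ (fun y => π.comp (v y) - w y) x)} = 0)
    (fun s t hst ht => measure_mono_null (by rintro π ⟨x, hx, h⟩; exact ⟨x, hst hx, h⟩) ht)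
    (fun S hS h => measure_mono_null (fun π hπ => ?_) ((measure_biUnion_null_iff hS).2 h)) ?_
  · obtain ⟨x, ⟨s, hs, hxs⟩, hx⟩ := hπ
    exact mem_iUnion₂.2 ⟨s, hs, x, hxs, hx⟩
  intro a ha
  obtain ⟨hva, hwa, hinj⟩ := hA a ha
  obtain ⟨R, hR⟩ : ∃ R : M →L[ℝ] K, R.comp (v a) = ContinuousLinearMap.id ℝ K := by
    obtain ⟨R, hR⟩ := LinearMap.exists_leftInverse_of_injective (v a : K →ₗ[ℝ] M)
      (LinearMap.ker_eq_bot.2 hinj)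
    exact ⟨LinearMap.toContinuousLinearMap R, ContinuousLinearMap.ext fun x =>
      DFunLike.congr_fun hR x⟩
  set c : (M →L[ℝ] P) →ₗ[ℝ] (K →L[ℝ] P) :=
    ((ContinuousLinearMap.compL ℝ K M P).flip (v a) : (M →L[ℝ] P) →ₗ[ℝ] (K →L[ℝ] P)) with hc
  have hcapp : ∀ π, c π = π.comp (v a) := fun π => rfl
  have hcsurj : Function.Surjective c := fun κ =>
    ⟨κ.comp R, by rw [hcapp, ContinuousLinearMap.comp_assoc, hR, ContinuousLinearMap.comp_id]⟩
  set T := LinearMap.ker c with hT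
  have hTdim : Module.finrank ℝ K * Module.finrank ℝ P + Module.finrank ℝ T =
      Module.finrank ℝ (M →L[ℝ] P) := by
    rw [← ContinuousLinearMap.finrank_eq_mul, ← LinearMap.finrank_range_add_finrank_ker c,
      LinearMap.range_eq_top.2 hcsurj, finrank_top]
  set J : X → K →L[ℝ] K := fun x => Ring.inverse (R.comp (v x)) with hJ
  -- Solves `π.comp (v x) = w x` near `a`: starting from `τ` in `T`, the defect `w x - τ.comp (v x)`
  -- is corrected through `J x ∘ R`, a left inverse of `v x`.
  set Φ : X × T → M →L[ℝ] P := fun p =>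
    (p.2 : M →L[ℝ] P) + ((w p.1 - (p.2 : M →L[ℝ] P).comp (v p.1)).comp (J p.1)).comp R with hΦ
  set t : Set X := {x | IsUnit (R.comp (v x))} with ht
  have htn : ∀ x, ContDiffAt ℝ k v x → x ∈ t → t ∈ 𝓝 x := fun x hx hxt => by
    have h1 : ContinuousAt (fun x => R.comp (v x)) x :=
      ((ContinuousLinearMap.compL ℝ K M K R).continuous.continuousAt).comp hx.continuousAt
    exact h1.preimage_mem_nhds (Units.isOpen.mem_nhds hxt)
  have hat : a ∈ t := by
    simp only [ht, mem_ofPred_eq, hR]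
    exact isUnit_one
  have hJv : ∀ x ∈ t, (J x).comp (R.comp (v x)) = ContinuousLinearMap.id ℝ K := fun x hx =>
    Ring.inverse_mul_cancel _ hx
  have hvJ : ∀ x ∈ t, (R.comp (v x)).comp (J x) = ContinuousLinearMap.id ℝ K := fun x hx =>
    Ring.mul_inverse_cancel _ hx
  have hΦv : ∀ p : X × T, p.1 ∈ t → (Φ p).comp (v p.1) = w p.1 := fun p hp => by
    simp only [hΦ, ContinuousLinearMap.add_comp, ContinuousLinearMap.comp_assoc, hJv _ hp,
      ContinuousLinearMap.comp_id]
    abel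
  have hΦc : ∀ p : X × T, p.1 ∈ A → p.1 ∈ t → ContDiffAt ℝ k Φ p := by
    rintro ⟨x, τ⟩ hxA hxt
    obtain ⟨u, hu⟩ := hxt
    have h1 : ContDiffAt ℝ k (fun p : X × T => v p.1) (x, τ) :=
      (hA x hxA).1.comp (x, τ) contDiffAt_fst
    have h2 : ContDiffAt ℝ k (fun p : X × T => w p.1) (x, τ) :=
      (hA x hxA).2.1.comp (x, τ) contDiffAt_fst
    have h3 : ContDiffAt ℝ k (fun p : X × T => (p.2 : M →L[ℝ] P)) (x, τ) :=
      (contDiff_snd_coe X T).contDiffAt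
    have h4 : ContDiffAt ℝ k (fun p : X × T => J p.1) (x, τ) := by
      have h5 : ContDiffAt ℝ k (fun p : X × T => R.comp (v p.1)) (x, τ) :=
        contDiffAt_const.clm_comp h1
      have h6 : ContDiffAt ℝ k Ring.inverse (R.comp (v (x, τ).1)) := by
        rw [← hu]
        exact contDiffAt_ringInverse ℝ u
      exact h6.comp (x, τ) h5
    exact h3.add (((h2.sub (h3.clm_comp h1)).clm_comp h4).clm_comp contDiffAt_const)
  refine ⟨_, inter_mem_nhdsWithin A (htn a hva hat), measure_mono_null
    (t := Φ '' {p | p.1 ∈ A ∩ t ∧ ¬ Function.Surjective (fderiv ℝ Φ p)}) ?_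
    (measure_image_not_surjective_fderiv_eq_zero μ (k := k) rfl hk ?_
      fun p hp => ⟨hΦc p hp.1.1 hp.1.2, hp.2⟩)⟩
  · rintro π ⟨x, ⟨hxA, hxt⟩, hπ, hns⟩
    -- The `T`-coordinate of a given solution `π`, so every solution is a value of `Φ`.
    have hτ : π - (π.comp (v a)).comp R ∈ T := by
      rw [hT, LinearMap.mem_ker, hcapp, ContinuousLinearMap.sub_comp,
        ContinuousLinearMap.comp_assoc _ R, hR, ContinuousLinearMap.comp_id, sub_self]
    set p : X × T := (x, ⟨_, hτ⟩) with hp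
    have hΦp : Φ p = π := by
      have h1 : (π - (π.comp (v a)).comp R).comp (v x) =
          w x - ((π.comp (v a)).comp (R.comp (v x))) := by
        rw [ContinuousLinearMap.sub_comp, hπ, ContinuousLinearMap.comp_assoc]
      simp only [hΦ, hp, h1, sub_sub_cancel]
      rw [ContinuousLinearMap.comp_assoc _ _ (J x), hvJ x hxt, ContinuousLinearMap.comp_id]
      abel
    refine ⟨p, ⟨⟨hxA, hxt⟩, fun hs => hns fun κ => ?_⟩, hΦp⟩
    have hvd : HasFDerivAt v (fderiv ℝ v x) x := ((hA x hxA).1.differentiableAt hk0).hasFDerivAt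
    have hwd : HasFDerivAt w (fderiv ℝ w x) x := ((hA x hxA).2.1.differentiableAt hk0).hasFDerivAt
    have hΦd : HasFDerivAt Φ (fderiv ℝ Φ p) p := ((hΦc p hxA hxt).differentiableAt hk0).hasFDerivAt
    have hfst : HasFDerivAt (Prod.fst : X × T → X) _ p :=
      hasFDerivAt_fst (𝕜 := ℝ)
    have hd1 := (hΦd.clm_comp (HasFDerivAt.comp (g := v) p hvd hfst)).sub
      (HasFDerivAt.comp (g := w) p hwd hfst)
    have hd0 : HasFDerivAt (fun p : X × T => (Φ p).comp (v p.1) - w p.1)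
        (0 : X × T →L[ℝ] K →L[ℝ] P) p := by
      refine (hasFDerivAt_const (0 : K →L[ℝ] P) p).congr_of_eventuallyEq ?_
      filter_upwards [continuousAt_fst.preimage_mem_nhds (htn x (hA x hxA).1 hxt)] with q hq
      rw [hΦv q hq, sub_self]
    have heq := hd1.unique hd0
    have hd2 : HasFDerivAt (fun y => π.comp (v y) - w y) _ x :=
      ((hasFDerivAt_const π x).clm_comp hvd).sub hwd
    rw [hd2.fderiv]
    -- Differentiating `Φ ∘ v = w` relates `dΦ` to the derivative of `π ∘ v - w`. The chosen
    -- direction composes with `v x` to `-κ`, so `ξ` is a preimage of `κ`.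
    obtain ⟨⟨ξ, τ⟩, hξ⟩ := hs (-(κ.comp ((J x).comp R)))
    refine ⟨ξ, ?_⟩
    have h1 := DFunLike.congr_fun heq (ξ, τ)
    simp only [sub_apply, add_apply,
      ContinuousLinearMap.comp_apply, ContinuousLinearMap.compL_apply,
      ContinuousLinearMap.flip_apply, hξ, hΦp, Function.comp_apply,
      zero_apply, ContinuousLinearMap.coe_fst'] at h1
    simp only [sub_apply, add_apply,
      ContinuousLinearMap.comp_apply, ContinuousLinearMap.compL_apply,
      ContinuousLinearMap.flip_apply, zero_apply,
      ContinuousLinearMap.zero_comp, add_zero]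
    have h2 : (κ.comp ((J x).comp R)).comp (v x) = κ := by
      rw [ContinuousLinearMap.comp_assoc, ContinuousLinearMap.comp_assoc, hJv x hxt,
        ContinuousLinearMap.comp_id]
    have h3 : (-(κ.comp ((J x).comp R))).comp (v p.1) = -κ := by
      rw [ContinuousLinearMap.neg_comp]
      exact congrArg _ h2
    rw [h3] at h1
    have h4 : π.comp (fderiv ℝ v x ξ) - fderiv ℝ w x ξ =
      (π.comp (fderiv ℝ v x ξ) + -κ - fderiv ℝ w x ξ) + κ := by abel
    rw [h4, h1, zero_add]
  · rw [Module.finrank_prod]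
    omega

/-- Parametric transversality to the diagonal for the maps `(x_i) ↦ (G_i x_i + π (h_i x_i))`. -/
theorem measure_not_transverse_diagonal_eq_zero {E M P : Type}
    [NormedAddCommGroup E] [NormedSpace ℝ E] [FiniteDimensional ℝ E]
    [NormedAddCommGroup M] [NormedSpace ℝ M] [FiniteDimensional ℝ M]
    [NormedAddCommGroup P] [NormedSpace ℝ P] [FiniteDimensional ℝ P]
    (μ : Measure (M →L[ℝ] P)) [μ.IsAddHaarMeasure] {j k : ℕ} (hk : 0 < k)
    (hdim : (j + 1) * Module.finrank ℝ E < j * Module.finrank ℝ P + k)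
    (h : Fin (j + 1) → E → M) (G : Fin (j + 1) → E → P) (A : Set (Fin (j + 1) → E))
    (hA : ∀ x ∈ A, (∀ i, ContDiffAt ℝ k (h i) (x i) ∧ ContDiffAt ℝ k (G i) (x i)) ∧
      LinearIndependent ℝ fun i : Fin j => h i.succ (x i.succ) - h 0 (x 0)) :
    μ {π : M →L[ℝ] P | ∃ x ∈ A, (∀ i, G i (x i) + π (h i (x i)) = G 0 (x 0) + π (h 0 (x 0))) ∧
      ¬ ∀ z : Fin j → P, ∃ ξ : Fin (j + 1) → E, ∀ i : Fin j,
        fderiv ℝ (fun y => G i.succ y + π (h i.succ y)) (x i.succ) (ξ i.succ) -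
          fderiv ℝ (fun y => G 0 y + π (h 0 y)) (x 0) (ξ 0) = z i} = 0 := by
  have hk0 : (k : ℕ∞ω) ≠ 0 := by exact_mod_cast hk.ne'
  set pr : Fin j → (Fin j → ℝ) →L[ℝ] ℝ := fun i => ContinuousLinearMap.proj i with hpr
  -- Injectivity of `v x` is independence of the differences, and `π ∘ v - w` encodes all
  -- differences of image points; its value on a basis vector recovers one of them.
  set v : (Fin (j + 1) → E) → (Fin j → ℝ) →L[ℝ] M := fun x =>
    ∑ i, (pr i).smulRight (h i.succ (x i.succ) - h 0 (x 0)) with hv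
  set w : (Fin (j + 1) → E) → (Fin j → ℝ) →L[ℝ] P := fun x =>
    ∑ i, (pr i).smulRight (G 0 (x 0) - G i.succ (x i.succ)) with hw
  have hvw : ∀ (π : M →L[ℝ] P) x, π.comp (v x) - w x = ∑ i, (pr i).smulRight
      ((G i.succ (x i.succ) + π (h i.succ (x i.succ))) - (G 0 (x 0) + π (h 0 (x 0)))) := by
    intro π x
    ext c
    simp only [hv, hw, sub_apply, ContinuousLinearMap.comp_apply, sum_apply,
      ContinuousLinearMap.smulRight_apply, map_sum, map_smul, map_sub, ← Finset.sum_sub_distrib,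
      ← smul_sub]
    refine Finset.sum_congr rfl fun i _ => ?_
    congr 1
    abel
  have hsingle : ∀ (z : Fin j → P) (i : Fin j),
      (∑ i, (pr i).smulRight (z i)) (Pi.single i 1) = z i := by
    intro z i
    rw [sum_apply, Finset.sum_eq_single i]
    · simp [hpr]
    · intro b _ hb
      simp [hpr, hb]
    · simp
  have happ : ∀ i : Fin (j + 1), ∀ x : Fin (j + 1) → E,
      ContDiffAt ℝ k (fun x : Fin (j + 1) → E => x i) x := fun i x => by fun_prop
  refine measure_mono_null ?_ (measure_not_surjective_fderiv_comp_sub_eq_zero μ (v := v) (w := w)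
    (k := k) (A := A) hk ?_ ?_)
  · rintro π ⟨x, hxA, heq, hns⟩
    refine ⟨x, hxA, ?_, fun hs => hns fun z => ?_⟩
    · rw [← sub_eq_zero, hvw]
      exact Finset.sum_eq_zero fun i _ => by rw [heq i.succ, sub_self]; ext; simp
    · obtain ⟨ξ, hξ⟩ := hs (∑ i, (pr i).smulRight (z i))
      refine ⟨ξ, fun i => ?_⟩
      have hgd : ∀ i, HasFDerivAt (fun y => G i y + π (h i y))
          (fderiv ℝ (fun y => G i y + π (h i y)) (x i)) (x i) := fun i => by
        have h1 : ContDiffAt ℝ k (fun y => G i y + π (h i y)) (x i) :=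
          ((hA x hxA).1 i).2.add (π.contDiff.contDiffAt.comp _ ((hA x hxA).1 i).1)
        exact (h1.differentiableAt hk0).hasFDerivAt
      have hgd' : ∀ i, HasFDerivAt (fun x : Fin (j + 1) → E => G i (x i) + π (h i (x i)))
          ((fderiv ℝ (fun y => G i y + π (h i y)) (x i)).comp (ContinuousLinearMap.proj i)) x :=
        fun i => HasFDerivAt.comp (g := fun y => G i y + π (h i y)) x (hgd i) (hasFDerivAt_apply i x)
      have hd : HasFDerivAt (fun y => π.comp (v y) - w y)
          (fderiv ℝ (fun y => π.comp (v y) - w y) x) x := by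
        refine DifferentiableAt.hasFDerivAt ?_
        simp only [hvw]
        refine DifferentiableAt.fun_sum fun i _ => ?_
        have h1 := ((hgd' i.succ).sub (hgd' 0)).differentiableAt
        exact ((ContinuousLinearMap.smulRightL ℝ (Fin j → ℝ) P (pr i)).differentiableAt).comp x h1
      have h1 := hd.clm_apply (hasFDerivAt_const (Pi.single i (1 : ℝ) : Fin j → ℝ) x)
      simp only [hvw, hsingle] at h1
      have h2 := DFunLike.congr_fun (h1.unique ((hgd' i.succ).sub (hgd' 0))) ξ
      simp only [← hvw] at h2
      simp [hξ, hsingle] at h2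
      exact h2.symm
  · simpa [Module.finrank_pi_fintype] using hdim
  · intro x hx
    obtain ⟨h1, h2⟩ := hA x hx
    have hh : ∀ i, ContDiffAt ℝ k (fun x : Fin (j + 1) → E => h i (x i)) x := fun i =>
      ContDiffAt.comp (g := h i) x (h1 i).1 (happ i x)
    have hG : ∀ i, ContDiffAt ℝ k (fun x : Fin (j + 1) → E => G i (x i)) x := fun i =>
      ContDiffAt.comp (g := G i) x (h1 i).2 (happ i x)
    refine ⟨ContDiffAt.sum fun i _ => contDiffAt_const.smulRight ((hh _).sub (hh _)),
      ContDiffAt.sum fun i _ => contDiffAt_const.smulRight ((hG _).sub (hG _)), ?_⟩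
    rw [injective_iff_map_eq_zero]
    intro c hc
    have h3 := Fintype.linearIndependent_iff.1 h2 c (by simpa [hv, hpr] using hc)
    exact funext h3

/-! ### Independence of difference vectors. -/

theorem infinite_of_chartedSpace {n : ℕ} (hn : 0 < n) (N : Type*) [TopologicalSpace N]
    [ChartedSpace (EuclideanSpace ℝ (Fin n)) N] [Nonempty N] : Infinite N := by
  obtain ⟨p⟩ := ‹Nonempty N›
  have : Nonempty (Fin n) := ⟨⟨0, hn⟩⟩
  have h1 : (chartAt (EuclideanSpace ℝ (Fin n)) p).target.Infinite :=
    infinite_of_mem_nhds _ (chart_target_mem_nhds _ p)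
  exact infinite_of_injOn_mapsTo (chartAt (EuclideanSpace ℝ (Fin n)) p).symm.injOn
    (mapsTo_univ _ _) h1 |> infinite_univ_iff.1

/-- Difference vectors of the images of `j + 1` distinct points are independent, as long as
`j + 1` is at most `independenceNumber f`. -/
theorem linearIndependent_of_le_independenceNumber {N : Type*} [Infinite N] {m j : ℕ}
    {f : N → EuclideanSpace ℝ (Fin m)} (hj : j + 1 ≤ independenceNumber f) (q : Fin (j + 1) → N)
    (hq : Function.Injective q) :
    LinearIndependent ℝ fun i : Fin j => f (q i.succ) - f (q 0) := by
  have hmem : independenceNumber f ∈ {s : ℕ | ∃ k : ℕ, s = k + 1 ∧ ∀ q : Fin (k + 1) → N,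
      Function.Injective q → Module.finrank ℝ
        (Submodule.span ℝ (Set.range fun i : Fin k => f (q i.succ) - f (q 0))) = k} := by
    -- On `ℕ`, `sSup` is 0 for an empty or unbounded set; `j + 1 ≤ independenceNumber f` excludes
    -- both.
    refine Nat.sSup_mem ?_ ?_
    · by_contra h
      rw [not_nonempty_iff_eq_empty] at h
      simp [independenceNumber, h] at hj
    · by_contra h
      have : independenceNumber f = 0 := csSup_of_not_bddAbove h |>.trans (by simp)
      omega
  obtain ⟨k, hk, hind⟩ := hmem
  have hmain : ∀ i, i ≤ k → ∀ q : Fin (i + 1) → N, Function.Injective q →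
      LinearIndependent ℝ fun a : Fin i => f (q a.succ) - f (q 0) := by
    intro i hi
    induction hi using Nat.decreasingInduction with
    | self =>
      intro q hq
      rw [linearIndependent_iff_card_eq_finrank_span, Fintype.card_fin]
      exact (hind q hq).symm
    | of_succ i hi ih =>
      intro q hq
      -- `N` is infinite, so a further point can be appended; the original family is then a
      -- subfamily of an independent one.
      obtain ⟨y, hy⟩ := (finite_range q).exists_notMem
      have h1 := (ih (Fin.snoc q y) (Fin.snoc_injective_of_injective hq hy)).comp Fin.castSucc
        (Fin.castSucc_injective i)
      convert h1 using 2 with a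
      · have h0 : (Fin.snoc q y : Fin (i + 2) → N) 0 = q 0 := Fin.snoc_castSucc (α := fun _ => N) y q 0
        simp only [Function.comp_apply]
        rw [Fin.succ_castSucc, Fin.snoc_castSucc, h0]
  exact hmain j (by omega) q hq

/-! ### Multi-point maps in charts. -/

theorem hasMFDerivAt_multiMap {n s : ℕ} {N V : Type*} [TopologicalSpace N] [T2Space N]
    [ChartedSpace (EuclideanSpace ℝ (Fin n)) N] [NormedAddCommGroup V] [NormedSpace ℝ V]
    {g : N → V} (hg : Continuous g) (q : configSpace N s)
    (D : Fin s → EuclideanSpace ℝ (Fin n) →L[ℝ] V)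
    (hD : ∀ i, HasFDerivAt (fun y => g ((chartAt (EuclideanSpace ℝ (Fin n)) (q.1 i)).symm y)) (D i)
      (chartAt (EuclideanSpace ℝ (Fin n)) (q.1 i) (q.1 i))) :
    HasMFDerivAt (ModelWithCorners.pi fun _ : Fin s => 𝓡 n) 𝓘(ℝ, Fin s → V) (multiMap g s) q
      (ContinuousLinearMap.pi fun i => (D i).comp (ContinuousLinearMap.proj i)) := by
  have hcont : Continuous (multiMap g s) :=
    continuous_pi fun i => hg.comp ((continuous_apply i).comp continuous_subtype_val)
  refine ⟨hcont.continuousAt, ?_⟩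
  set x := extChartAt (ModelWithCorners.pi fun _ : Fin s => 𝓡 n) q q with hx
  have hxi : ∀ i, x i = chartAt (EuclideanSpace ℝ (Fin n)) (q.1 i) (q.1 i) := fun i => rfl
  -- The chart of the configuration space at `q` restricts the product of the charts at the points
  -- `q i`, so its inverse acts coordinatewise.
  have hval : ∀ᶠ y in 𝓝[range (ModelWithCorners.pi fun _ : Fin s => 𝓡 n)] x,
      ∀ i, ((extChartAt (ModelWithCorners.pi fun _ : Fin s => 𝓡 n) q).symm y).1 i =
        (chartAt (EuclideanSpace ℝ (Fin n)) (q.1 i)).symm (y i) := by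
    filter_upwards [extChartAt_target_mem_nhdsWithin (I := ModelWithCorners.pi fun _ : Fin s => 𝓡 n) q]
      with y hy i
    rw [extChartAt_target] at hy
    have h1 := (chartAt (ModelPi fun _ : Fin s => EuclideanSpace ℝ (Fin n)) q.1).subtypeRestr_symm_eqOn
      ⟨q⟩ hy.1
    exact (congrFun h1 i).symm
  have hder : HasFDerivWithinAt (fun y : Fin s → EuclideanSpace ℝ (Fin n) => fun i =>
      g ((chartAt (EuclideanSpace ℝ (Fin n)) (q.1 i)).symm (y i)))
      (ContinuousLinearMap.pi fun i => (D i).comp (ContinuousLinearMap.proj i))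
      (range (ModelWithCorners.pi fun _ : Fin s => 𝓡 n)) x := by
    refine HasFDerivAt.hasFDerivWithinAt (hasFDerivAt_pi.2 fun i => ?_)
    have h1 := hD i
    rw [← hxi] at h1
    exact HasFDerivAt.comp (g := fun y => g ((chartAt (EuclideanSpace ℝ (Fin n)) (q.1 i)).symm y)) x
      h1 (hasFDerivAt_apply i x)
  refine hder.congr_of_eventuallyEq ?_ ?_
  · filter_upwards [hval] with y hy
    funext i
    exact congrArg g (hy i)
  · have hmem : x ∈ range (ModelWithCorners.pi fun _ : Fin s => 𝓡 n) :=
      extChartAt_target_subset_range q (mem_extChartAt_target q)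
    funext i
    exact congrArg g (hval.self_of_nhdsWithin hmem i)

/-- Transversality of `g^(s)` to the diagonal at `q`, from transversality read in arbitrary charts
around the points `q i`. -/
theorem range_mfderiv_multiMap_sup_diagonal_eq_top {n ℓ j : ℕ} {N : Type*} [TopologicalSpace N]
    [T2Space N] [ChartedSpace (EuclideanSpace ℝ (Fin n)) N] [IsManifold (𝓡 n) 1 N]
    {g : N → EuclideanSpace ℝ (Fin ℓ)} (hg : ContMDiff (𝓡 n) (𝓡 ℓ) 1 g)
    (q : configSpace N (j + 1)) (p : Fin (j + 1) → N)
    (hqp : ∀ i, q.1 i ∈ (chartAt (EuclideanSpace ℝ (Fin n)) (p i)).source)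
    (hz : ∀ z : Fin j → EuclideanSpace ℝ (Fin ℓ), ∃ ξ : Fin (j + 1) → EuclideanSpace ℝ (Fin n),
      ∀ i : Fin j,
        fderiv ℝ (fun y => g ((chartAt (EuclideanSpace ℝ (Fin n)) (p i.succ)).symm y))
          (chartAt (EuclideanSpace ℝ (Fin n)) (p i.succ) (q.1 i.succ)) (ξ i.succ) -
        fderiv ℝ (fun y => g ((chartAt (EuclideanSpace ℝ (Fin n)) (p 0)).symm y))
          (chartAt (EuclideanSpace ℝ (Fin n)) (p 0) (q.1 0)) (ξ 0) = z i) :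
    LinearMap.range (mfderiv (ModelWithCorners.pi fun _ : Fin (j + 1) => 𝓡 n)
      𝓘(ℝ, Fin (j + 1) → EuclideanSpace ℝ (Fin ℓ)) (multiMap g (j + 1)) q).toLinearMap ⊔
      diagonalSubspace ℓ (j + 1) = ⊤ := by
  set φ : N → OpenPartialHomeomorph N (EuclideanSpace ℝ (Fin n)) :=
    fun a => chartAt (EuclideanSpace ℝ (Fin n)) a with hφ
  have hgφ : ∀ a, ∀ y ∈ (φ a).target, DifferentiableAt ℝ (fun y => g ((φ a).symm y)) y := by
    intro a y hy
    have h1 : ContMDiffOn (𝓡 n) (𝓡 ℓ) 1 (g ∘ (φ a).symm) (φ a).target :=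
      hg.comp_contMDiffOn contMDiffOn_chart_symm
    exact ((contMDiffOn_iff_contDiffOn.1 h1).contDiffAt ((φ a).open_target.mem_nhds hy)
      ).differentiableAt one_ne_zero
  have hφφ : ∀ a b, ∀ c ∈ (φ a).source ∩ (φ b).source,
      DifferentiableAt ℝ (fun y => φ b ((φ a).symm y)) (φ a c) := by
    intro a b c hc
    have h1 : ContMDiffOn (𝓡 n) (𝓡 n) 1 (φ b ∘ (φ a).symm)
        ((φ a).target ∩ (φ a).symm ⁻¹' (φ b).source) :=
      contMDiffOn_chart.comp (contMDiffOn_chart_symm.mono inter_subset_left) fun y hy => hy.2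
    refine ((contMDiffOn_iff_contDiffOn.1 h1).contDiffAt
      (((φ a).isOpen_inter_preimage_symm (φ b).open_source).mem_nhds ⟨?_, ?_⟩)
      ).differentiableAt one_ne_zero
    · exact (φ a).map_source hc.1
    · change (φ a).symm (φ a c) ∈ (φ b).source
      rw [(φ a).left_inv hc.1]
      exact hc.2
  have hD := hasMFDerivAt_multiMap hg.continuous q _ fun i =>
    (hgφ (q.1 i) _ ((φ (q.1 i)).map_source (mem_chart_source _ _))).hasFDerivAt
  -- Chain rule with the transition map from the chart at `p i` to the one at `q i`, which `mfderiv`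
  -- uses.
  have htr : ∀ i η, ∃ η', fderiv ℝ (fun y => g ((φ (p i)).symm y)) (φ (p i) (q.1 i)) η =
      fderiv ℝ (fun y => g ((φ (q.1 i)).symm y)) (φ (q.1 i) (q.1 i)) η' := by
    intro i η
    have hsrc : q.1 i ∈ (φ (p i)).source ∩ (φ (q.1 i)).source := ⟨hqp i, mem_chart_source _ _⟩
    have hleft : (φ (p i)).symm (φ (p i) (q.1 i)) = q.1 i := (φ (p i)).left_inv (hqp i)
    have h1 : (fun y => g ((φ (p i)).symm y)) =ᶠ[𝓝 (φ (p i) (q.1 i))]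
        (fun y => g ((φ (q.1 i)).symm y)) ∘ (fun y => φ (q.1 i) ((φ (p i)).symm y)) := by
      have h2 : ContinuousAt (φ (p i)).symm (φ (p i) (q.1 i)) :=
        (φ (p i)).continuousAt_symm ((φ (p i)).map_source (hqp i))
      have h3 : (φ (q.1 i)).source ∈ 𝓝 ((φ (p i)).symm (φ (p i) (q.1 i))) := by
        rw [hleft]
        exact (φ (q.1 i)).open_source.mem_nhds hsrc.2
      filter_upwards [h2.preimage_mem_nhds h3] with y hy
      simp only [Function.comp_apply]
      rw [(φ (q.1 i)).left_inv hy]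
    refine ⟨fderiv ℝ (fun y => φ (q.1 i) ((φ (p i)).symm y)) (φ (p i) (q.1 i)) η, ?_⟩
    rw [h1.fderiv_eq, fderiv_comp _ ?_ (hφφ _ _ _ hsrc)]
    · simp only [ContinuousLinearMap.comp_apply, hleft]
    · rw [hleft]
      exact hgφ _ _ ((φ (q.1 i)).map_source hsrc.2)
  rw [hD.mfderiv, eq_top_iff]
  rintro Z -
  obtain ⟨ξ, hξ⟩ := hz fun i => Z i.succ - Z 0
  -- The differences of `Z` are matched by `ξ`; what remains is the same vector in every coordinate,
  -- hence diagonal.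
  choose η hη using fun i => htr i (ξ i)
  refine Submodule.mem_sup.2 ⟨_, ⟨η, rfl⟩, _, ⟨Z 0 - fderiv ℝ (fun y => g ((φ (p 0)).symm y))
    (φ (p 0) (q.1 0)) (ξ 0), rfl⟩, ?_⟩
  have hZ : ∀ i, fderiv ℝ (fun y => g ((φ (p i)).symm y)) (φ (p i) (q.1 i)) (ξ i) +
      (Z 0 - fderiv ℝ (fun y => g ((φ (p 0)).symm y)) (φ (p 0) (q.1 0)) (ξ 0)) = Z i := by
    intro i
    refine Fin.cases ?_ (fun i => ?_) i
    · abel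
    · have h1 := sub_eq_iff_eq_add.1 (hξ i)
      rw [h1]
      abel
  funext i
  rw [← hZ i, hη i]
  rfl

/-- A transverse map from a manifold of too small a dimension misses the diagonal. -/
theorem lt_of_range_sup_diagonal_eq_top {n ℓ s : ℕ}
    (L : (Fin s → EuclideanSpace ℝ (Fin n)) →ₗ[ℝ] (Fin s → EuclideanSpace ℝ (Fin ℓ)))
    (h : LinearMap.range L ⊔ diagonalSubspace ℓ s = ⊤) : s * ℓ ≤ s * n + ℓ := by
  have h1 := Submodule.finrank_add_le_finrank_add_finrank (LinearMap.range L) (diagonalSubspace ℓ s)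
  have h2 := LinearMap.finrank_range_le L
  have h3 : Module.finrank ℝ (diagonalSubspace ℓ s) ≤ ℓ := by
    have h4 : diagonalSubspace ℓ s = LinearMap.range
        (LinearMap.pi fun _ : Fin s => (LinearMap.id : EuclideanSpace ℝ (Fin ℓ) →ₗ[ℝ] _)) := by
      ext z
      constructor
      · rintro ⟨y, rfl⟩
        exact ⟨y, rfl⟩
      · rintro ⟨y, rfl⟩
        exact ⟨y, rfl⟩
    rw [h4]
    exact (LinearMap.finrank_range_le _).trans (by simp)
  rw [h, finrank_top] at h1
  simp only [Module.finrank_pi_fintype, finrank_euclideanSpace_fin, Finset.sum_const,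
    Finset.card_univ, Fintype.card_fin, smul_eq_mul] at h1 h2
  omega

/-! ### Null sets of linear maps and the global statement. -/

theorem exists_isAddHaarMeasure_isLebesgueNull (m ℓ : ℕ) :
    ∃ μ : Measure (EuclideanSpace ℝ (Fin m) →L[ℝ] EuclideanSpace ℝ (Fin ℓ)), μ.IsAddHaarMeasure ∧
      ∀ B, μ B = 0 → IsLebesgueNull
        ((fun π : EuclideanSpace ℝ (Fin m) →L[ℝ] EuclideanSpace ℝ (Fin ℓ) => π.toLinearMap) '' B) := by
  set Λ : (EuclideanSpace ℝ (Fin m) →L[ℝ] EuclideanSpace ℝ (Fin ℓ)) →ₗ[ℝ] (Fin ℓ → Fin m → ℝ) :=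
    { toFun := fun π => linearMapEntries π.toLinearMap
      map_add' := fun _ _ => rfl
      map_smul' := fun _ _ => rfl } with hΛ
  have hinj : Function.Injective Λ := by
    intro π π' h
    refine ContinuousLinearMap.coe_injective
      ((EuclideanSpace.basisFun (Fin m) ℝ).toBasis.ext fun i => ?_)
    ext a
    have h1 : π (EuclideanSpace.single i 1) a = π' (EuclideanSpace.single i 1) a :=
      congrFun (congrFun h a) i
    simpa using h1
  have hdim : Module.finrank ℝ (EuclideanSpace ℝ (Fin m) →L[ℝ] EuclideanSpace ℝ (Fin ℓ)) =
      Module.finrank ℝ (Fin ℓ → Fin m → ℝ) := by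
    rw [ContinuousLinearMap.finrank_eq_mul]
    simp [Module.finrank_pi_fintype, mul_comm]
  set e := (LinearMap.linearEquivOfInjective Λ hinj hdim).toContinuousLinearEquiv with he
  refine ⟨(volume : Measure (Fin ℓ → Fin m → ℝ)).map e.symm,
    ContinuousLinearEquiv.isAddHaarMeasure_map e.symm volume, fun B hB => ?_⟩
  refine measure_mono_null ?_
    ((e.symm.toHomeomorph.measurableEmbedding.map_apply volume B).symm.trans hB)
  rintro _ ⟨_, ⟨π, hπ, rfl⟩, rfl⟩
  have : e.symm (linearMapEntries π.toLinearMap) = π := e.symm_apply_apply π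
  change e.symm (linearMapEntries π.toLinearMap) ∈ B
  rwa [this]

/-- For almost every `π`, the map `(F_π ∘ f)^(j + 1)` is transverse to the diagonal. -/
theorem exists_null_forall_transverse {n m ℓ j k : ℕ} {N : Type*} [TopologicalSpace N] [T2Space N]
    [SecondCountableTopology N] [ChartedSpace (EuclideanSpace ℝ (Fin n)) N]
    [IsManifold (𝓡 n) (k : ℕ∞ω) N] (hk : 0 < k) (hdim : (j + 1) * n < j * ℓ + k)
    {U : Set (EuclideanSpace ℝ (Fin m))} (hU : IsOpen U) {f : N → EuclideanSpace ℝ (Fin m)}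
    (hf : ContMDiff (𝓡 n) (𝓡 m) (k : ℕ∞ω) f) (hfU : ∀ q, f q ∈ U)
    {F : EuclideanSpace ℝ (Fin m) → EuclideanSpace ℝ (Fin ℓ)} (hF : ContDiffOn ℝ (k : ℕ∞ω) F U)
    (hind : ∀ q : Fin (j + 1) → N, Function.Injective q →
      LinearIndependent ℝ fun i : Fin j => f (q i.succ) - f (q 0))
    (μ : Measure (EuclideanSpace ℝ (Fin m) →L[ℝ] EuclideanSpace ℝ (Fin ℓ))) [μ.IsAddHaarMeasure] :
    ∃ B, μ B = 0 ∧ ∀ π ∉ B, ContMDiff (𝓡 n) (𝓡 ℓ) 1 (linearPerturbation F π.toLinearMap ∘ f) →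
      IsTransverseTo (ModelWithCorners.pi fun _ : Fin (j + 1) => 𝓡 n)
        (multiMap (linearPerturbation F π.toLinearMap ∘ f) (j + 1)) (diagonalSubspace ℓ (j + 1)) := by
  set φ : N → OpenPartialHomeomorph N (EuclideanSpace ℝ (Fin n)) :=
    fun a => chartAt (EuclideanSpace ℝ (Fin n)) a with hφ
  have : IsManifold (𝓡 n) 1 N := IsManifold.of_le (n := (k : ℕ∞ω)) (by exact_mod_cast hk)
  have hnhds : ∀ p : configSpace N (j + 1),
      {q : configSpace N (j + 1) | ∀ i, q.1 i ∈ (φ (p.1 i)).source} ∈ 𝓝 p := fun p => by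
    have h1 : {q : configSpace N (j + 1) | ∀ i, q.1 i ∈ (φ (p.1 i)).source} =
        ⋂ i, {q : configSpace N (j + 1) | q.1 i ∈ (φ (p.1 i)).source} := by
      ext
      simp
    rw [h1, iInter_mem]
    intro i
    have h2 : Continuous fun q : configSpace N (j + 1) => q.1 i :=
      (continuous_apply i).comp continuous_subtype_val
    exact h2.continuousAt.preimage_mem_nhds (chart_source_mem_nhds _ _)
  obtain ⟨C, hC, hCu⟩ := TopologicalSpace.countable_cover_nhds hnhds
  set A : configSpace N (j + 1) → Set (Fin (j + 1) → EuclideanSpace ℝ (Fin n)) := fun p =>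
    {x | (∀ i, x i ∈ (φ (p.1 i)).target) ∧
      Function.Injective fun i => (φ (p.1 i)).symm (x i)} with hA
  have hfφ : ∀ a, ContDiffOn ℝ k (fun y => f ((φ a).symm y)) (φ a).target := fun a =>
    contMDiffOn_iff_contDiffOn.1 (hf.comp_contMDiffOn contMDiffOn_chart_symm)
  set h : configSpace N (j + 1) → Fin (j + 1) → EuclideanSpace ℝ (Fin n) →
    EuclideanSpace ℝ (Fin m) := fun p i y => f ((φ (p.1 i)).symm y) with hh
  have hA' : ∀ p, ∀ x ∈ A p, (∀ i, ContDiffAt ℝ k (h p i) (x i) ∧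
      ContDiffAt ℝ k (fun y => F (h p i y)) (x i)) ∧
      LinearIndependent ℝ fun i : Fin j => h p i.succ (x i.succ) - h p 0 (x 0) := by
    intro p x hx
    refine ⟨fun i => ?_, hind (fun i => (φ (p.1 i)).symm (x i)) hx.2⟩
    have h1 : ContDiffAt ℝ k (h p i) (x i) :=
      (hfφ _).contDiffAt ((φ (p.1 i)).open_target.mem_nhds (hx.1 i))
    exact ⟨h1, (hF.contDiffAt (hU.mem_nhds (hfU ((φ (p.1 i)).symm (x i))))).comp (g := F) (f := h p i) (x i) h1⟩
  have hdim' : (j + 1) * Module.finrank ℝ (EuclideanSpace ℝ (Fin n)) <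
      j * Module.finrank ℝ (EuclideanSpace ℝ (Fin ℓ)) + k := by
    simpa only [finrank_euclideanSpace_fin] using hdim
  have hnull := fun p : configSpace N (j + 1) =>
    measure_not_transverse_diagonal_eq_zero μ hk hdim' (h p) (fun i y => F (h p i y)) (A p) (hA' p)
  refine ⟨_, (measure_biUnion_null_iff hC).2 fun p _ => hnull p, fun π hπ hg q hq => ?_⟩
  obtain ⟨p, hpC, hqp⟩ := mem_iUnion₂.1 (hCu ▸ mem_univ q : q ∈ ⋃ x ∈ C, _)
  have hqp : ∀ i, q.1 i ∈ (φ (p.1 i)).source := hqp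
  have hleft : ∀ i, (φ (p.1 i)).symm (φ (p.1 i) (q.1 i)) = q.1 i := fun i =>
    (φ (p.1 i)).left_inv (hqp i)
  refine range_mfderiv_multiMap_sup_diagonal_eq_top hg q p.1 hqp ?_
  by_contra hz
  refine hπ (mem_iUnion₂.2 ⟨p, hpC, fun i => φ (p.1 i) (q.1 i),
    ⟨fun i => (φ (p.1 i)).map_source (hqp i), ?_⟩, fun i => ?_, hz⟩)
  · have h1 : Function.Injective q.1 := q.2
    simpa only [hleft] using h1
  · simp only [hh, hleft]
    obtain ⟨y, hy⟩ := hq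
    exact (congrFun hy i).trans (congrFun hy 0).symm

theorem mainTheorem9 {n m ℓ : ℕ} (hn : 0 < n) {r : ℕ∞}
    {N : Type*} [TopologicalSpace N] [T2Space N] [SecondCountableTopology N] [Nonempty N]
    [ChartedSpace (EuclideanSpace ℝ (Fin n)) N] [IsManifold (𝓡 n) (r : ℕ∞ω) N]
    (U : Set (EuclideanSpace ℝ (Fin m))) (hU : IsOpen U)
    (f : N → EuclideanSpace ℝ (Fin m)) (hf : ContMDiff (𝓡 n) (𝓡 m) (r : ℕ∞ω) f)
    (hf_inj : Function.Injective f) (hfU : ∀ q, f q ∈ U)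
    (F : EuclideanSpace ℝ (Fin m) → EuclideanSpace ℝ (Fin ℓ))
    (hF : ContDiffOn ℝ (r : ℕ∞ω) F U)
    (h_dim : (n : ℤ) * (independenceNumber f : ℤ) < ((independenceNumber f : ℤ) - 1) * (ℓ : ℤ))
    (hr : ((max (2 * (n : ℤ) - (ℓ : ℤ)) 0).toNat : ℕ∞) < r) :
    ∃ S : Set (EuclideanSpace ℝ (Fin m) →ₗ[ℝ] EuclideanSpace ℝ (Fin ℓ)),
      IsLebesgueNull S ∧
      ∀ π : EuclideanSpace ℝ (Fin m) →ₗ[ℝ] EuclideanSpace ℝ (Fin ℓ), π ∉ S →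
        ContMDiff (𝓡 n) (𝓡 ℓ) (r : ℕ∞ω) (linearPerturbation F π ∘ f) ∧
        HasNormalCrossings n (linearPerturbation F π ∘ f) ∧
        Set.range (multiMap (linearPerturbation F π ∘ f) (independenceNumber f)) ∩
          (diagonalSubspace ℓ (independenceNumber f) :
            Set (Fin (independenceNumber f) → EuclideanSpace ℝ (Fin ℓ))) = ∅ := by
  set S := independenceNumber f with hS
  have : Infinite N := infinite_of_chartedSpace hn N
  have hS2 : 2 ≤ S := by
    by_contra! h
    have : (S : ℤ) = 0 ∨ (S : ℤ) = 1 := by omega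
    rcases this with h1 | h1 <;> rw [h1] at h_dim <;> nlinarith
  have hnℓ : n < ℓ := by
    by_contra! h
    have h1 : (ℓ : ℤ) ≤ n := by exact_mod_cast h
    have h2 : (2 : ℤ) ≤ S := by exact_mod_cast hS2
    nlinarith
  -- Sard's theorem is applied with a finite class, also when `r` is infinite: the least `k ≥ 1`
  -- with `2 * n < ℓ + k`.
  set k := (max (2 * (n : ℤ) - (ℓ : ℤ)) 0).toNat + 1 with hk
  have hk0 : 0 < k := Nat.succ_pos _
  have hkn : 2 * n < ℓ + k := by omega
  have hkr : (k : ℕ∞ω) ≤ (r : ℕ∞ω) := by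
    have h1 : (k : ℕ∞) ≤ r := by
      rw [hk, Nat.cast_add, Nat.cast_one]
      exact Order.add_one_le_of_lt hr
    exact_mod_cast h1
  have h1r : (1 : ℕ∞ω) ≤ (r : ℕ∞ω) := le_trans (by exact_mod_cast hk0) hkr
  have : IsManifold (𝓡 n) (k : ℕ∞ω) N := IsManifold.of_le hkr
  -- Each further point adds `n` on the left and `ℓ > n` on the right, so the case `j = 1` decides.
  have hdim : ∀ j, 1 ≤ j → (j + 1) * n < j * ℓ + k := fun j hj => by
    obtain ⟨i, rfl⟩ : ∃ i, j = i + 1 := ⟨j - 1, by omega⟩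
    have : i * n ≤ i * ℓ := Nat.mul_le_mul_left i hnℓ.le
    linarith [this, hkn, add_mul i 1 ℓ, add_mul (i + 1) 1 n, add_mul i 1 n]
  obtain ⟨μ, hμ, hμn⟩ := exists_isAddHaarMeasure_isLebesgueNull m ℓ
  have hex : ∀ j, ∃ B, μ B = 0 ∧ ∀ π ∉ B, 1 ≤ j → j + 1 ≤ S →
      ContMDiff (𝓡 n) (𝓡 ℓ) 1 (linearPerturbation F π.toLinearMap ∘ f) →
      IsTransverseTo (ModelWithCorners.pi fun _ : Fin (j + 1) => 𝓡 n)
        (multiMap (linearPerturbation F π.toLinearMap ∘ f) (j + 1))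
        (diagonalSubspace ℓ (j + 1)) := fun j => by
    by_cases hj : 1 ≤ j ∧ j + 1 ≤ S
    · obtain ⟨B, hB, h⟩ := exists_null_forall_transverse hk0 (hdim j hj.1) hU (hf.of_le hkr) hfU
        (hF.of_le hkr) (linearIndependent_of_le_independenceNumber hj.2) μ
      exact ⟨B, hB, fun π hπ _ _ => h π hπ⟩
    · exact ⟨∅, measure_empty, fun π _ h1 h2 => absurd ⟨h1, h2⟩ hj⟩
  choose B hB hBt using hex
  refine ⟨_, hμn (⋃ j, B j) (measure_iUnion_null hB), fun π hπ => ?_⟩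
  have hg : ContMDiff (𝓡 n) (𝓡 ℓ) (r : ℕ∞ω) (linearPerturbation F π ∘ f) := fun q => by
    have h1 : ContDiffAt ℝ (r : ℕ∞ω) (linearPerturbation F π) (f q) :=
      (hF.contDiffAt (hU.mem_nhds (hfU q))).add
        (LinearMap.toContinuousLinearMap π).contDiff.contDiffAt
    exact h1.contMDiffAt.comp q (hf q)
  have htrans : ∀ j, 1 ≤ j → j + 1 ≤ S →
      IsTransverseTo (ModelWithCorners.pi fun _ : Fin (j + 1) => 𝓡 n)
        (multiMap (linearPerturbation F π ∘ f) (j + 1)) (diagonalSubspace ℓ (j + 1)) :=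
    fun j hj hjS => hBt j (LinearMap.toContinuousLinearMap π)
      (fun h => hπ ⟨_, mem_iUnion.2 ⟨j, h⟩, rfl⟩) hj hjS (hg.of_le h1r)
  have hempty : ∀ q : configSpace N S,
      multiMap (linearPerturbation F π ∘ f) S q ∉ diagonalSubspace ℓ S := by
    obtain ⟨j, hj⟩ : ∃ j, S = j + 1 := ⟨S - 1, by omega⟩
    have ht := htrans j (by omega) hj.ge
    rw [← hj] at ht
    intro q hq
    have h1 := lt_of_range_sup_diagonal_eq_top _ (ht q hq)
    have h2 : (S : ℤ) * ℓ ≤ S * n + ℓ := by exact_mod_cast h1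
    nlinarith
  refine ⟨hg, ⟨hg.of_le h1r, fun s hs => ?_⟩, ?_⟩
  · rcases le_or_gt s S with hsS | hsS
    · obtain ⟨j, rfl⟩ : ∃ j, s = j + 1 := ⟨s - 1, by omega⟩
      exact htrans j (by omega) hsS
    -- Among `s > S` coinciding points, the first `S` already coincide, which is impossible.
    · rintro q ⟨y, hy⟩
      refine absurd ⟨y, ?_⟩ (hempty ⟨fun i => q.1 (Fin.castLE hsS.le i),
        q.2.comp (Fin.castLE_injective hsS.le)⟩)
      funext i
      exact congrFun hy (Fin.castLE hsS.le i)
  · rw [eq_empty_iff_forall_notMem]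
    rintro _ ⟨⟨q, rfl⟩, hq⟩
    exact hempty q hq
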